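/- **Setting.** A classical signature is a triple $\mathsf s=(\star,p,q)$ with $\star\in\{B,C,D,\widetilde C,C^*,D^*\}$ and $p,q\in\mathbb N$, where $p+q$ is odd if $\star=B$, $p+q$ is even if $\star=D$, $p=q$ if $\star\in\{C,\widetilde C,D^*\}$, and $p,q$ are both even if $\star=C^*$. Put $\epsilon=1$ if $\star\in\{B,D,D^*\}$ and $\epsilon=-1$ otherwise; put $\dot\epsilon=1$ if $\star\in\{B,D,C^*\}$ and $\dot\epsilon=-1$ otherwise. A classical space of signature $\mathsf s$ is $(\mathscr V,\langle\,,\rangle,J,L)$, where $\mathscr V$ is a complex vector space of dimension $p+q$; $\langle\,,\rangle$ is a non-degenerate bilinear form with $\langle u,v\rangle=\epsilon\langle v,u\rangle$; $J$ is a conjugate-linear automorphism with $J^2=\epsilon\dot\epsilon$ and $\langle Ju,Jv\rangle=\overline{\langle u,v\rangle}$; $L$ is a linear automorphism with $L^2=\dot\epsilon$, $\langle Lu,Lv\rangle=\langle u,v\rangle$ and $LJ=JL$; the Hermitian form $(u,v)\mapsto\langle Lu,Jv\rangle$ is positive definite; and, if $\dot\epsilon=1$, the eigenspaces of $L$ for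 $1$ and $-1$ have dimensions $p$ and $q$. Let $\mathbf G$ be the isometry group of $\langle\,,\rangle$ and $\mathbf G^L$ the centralizer of $L$ in $\mathbf G$. Let $\mathbf K=\mathbf G^L$ if $\star\neq\widetilde C$; if $\star=\widetilde C$ let $\mathbf K=\{(g,t)\in\mathbf G^L\times\mathbb C^\times : t^2=\det(g|_{\ker(L-i)})\}$, acting through $\mathbf G^L$ (this is the complexification of a maximal compact subgroup of the metaplectic group). Let $\mathfrak g$ be the Lie algebra of $\mathbf G$ and $\mathfrak p=\{X\in\mathfrak g: LX=-XL\}$, on which $\mathbf K$ acts by conjugation. Let $\mathscr V,\mathscr V'$ be classical spaces with $\epsilon'=-\epsilon$ and $\dot\epsilon'=-\dot\epsilon$ (as holds whenever the labels $\star,\star'$ are Howe dual to each other), with primes marking the objects attached to $\mathscr V'$. Fix a square root $\sqrt{-1}$ of $-1$. For $\phi\in\mathscr W:=\operatorname{Hom}_{\mathbb C}(\mathscr V,\mathscr V')$ let $\phi^*:\mathscr V'\to\mathscr V$ be the adjoint, $\langle\phi v,v'\rangle_{\mathscr V'}=\langle v,\phi^*v'\rangle_{\mathscr V}$. Put $$\mathscr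 X=\{\phi\in\mathscr W: L\phi^*=\sqrt{-1}\,\dot\epsilon\,\phi^*L'\},\qquad \mathscr X^{su}=\{\phi\in\mathscr X:\ \langle\,,\rangle_{\mathscr V}\text{ is non-degenerate on }\operatorname{Im}(\phi^*)\},$$ with $\mathbf K\times\mathbf K'$ acting on $\mathscr X$ by $(k,k')\cdot\phi=k'\phi k^{-1}$, and let $M':\mathscr X\to\mathfrak p'$, $M'(\phi)=\phi\phi^*$. **Proposition (descent of $\mathbf K$-orbits in $\mathfrak p$).** Let $\mathscr O'$ be a $\mathbf K'$-orbit in $\mathfrak p'$ contained in the image of $M'$. Then $(M')^{-1}(\mathscr O')\cap\mathscr X^{su}$ is a single (in particular non-empty) $\mathbf K\times\mathbf K'$-orbit. Moreover, for every $\phi\in(M')^{-1}(\mathscr O')\cap\mathscr X^{su}$, with $e'=M'(\phi)$, there is an exact sequence of algebraic groups $$1\to\mathbf K_\phi\to(\mathbf K\times\mathbf K')_\phi\to\mathbf K'_{e'}\to1,$$ where subscripts denote stabilizers, the first map is $k\mapsto(k,1)$ and the second is the projection to the second factor. -/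

import Mathlib

open Module

/-! ### Affine algebraic groups over the complex numbers, through their points -/

section AlgebraicGroups

/-- Polynomial functions on a complex vector space: the algebra generated by linear functionals. -/
def PolyFun (E : Type*) [AddCommGroup E] [Module ℂ E] : Subalgebra ℂ (E → ℂ) :=
  Algebra.adjoin ℂ (Set.range fun f : Dual ℂ E => (f : E → ℂ))

/-- Zariski closed subsets of a complex vector space. -/
def IsZariskiClosed {E : Type*} [AddCommGroup E] [Module ℂ E] (Z : Set E) : Prop :=
  ∃ S : Set (E → ℂ), S ⊆ (PolyFun E : Set (E → ℂ)) ∧ Z = {x | ∀ f ∈ S, f x = 0}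

/-- The coordinates `c : H → E` present the group `H` as an affine algebraic group: they identify
`H` with a Zariski closed subset of `E` on which multiplication and inversion are regular. -/
structure IsAffineAlgebraicGroup {H E : Type*} [Group H] [AddCommGroup E] [Module ℂ E]
    (c : H → E) : Prop where
  injective : Function.Injective c
  closed : IsZariskiClosed (Set.range c)
  regular_mul : ∀ P ∈ PolyFun E, ∃ Q ∈ PolyFun (E × E), ∀ g h : H, P (c (g * h)) = Q (c g, c h)
  regular_inv : ∀ P ∈ PolyFun E, ∃ Q ∈ PolyFun E, ∀ g : H, P (c g⁻¹) = Q (c g)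

/-- Regularity of a map between two groups with coordinates: regular functions pull back to
regular functions. -/
def IsRegularMap {H₁ H₂ E₁ E₂ : Type*} [AddCommGroup E₁] [Module ℂ E₁] [AddCommGroup E₂]
    [Module ℂ E₂] (c₁ : H₁ → E₁) (c₂ : H₂ → E₂) (f : H₁ → H₂) : Prop :=
  ∀ P ∈ PolyFun E₂, ∃ Q ∈ PolyFun E₁, ∀ h : H₁, P (c₂ (f h)) = Q (c₁ h)

/-- `1 → H₁ → H₂ → H₃ → 1` (with maps `i` and `p`) is an exact sequence of affine algebraic
groups. -/
structure IsExactSeqOfAlgebraicGroups {H₁ H₂ H₃ E₁ E₂ E₃ : Type*} [Group H₁] [Group H₂] [Group H₃]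
    [AddCommGroup E₁] [Module ℂ E₁] [AddCommGroup E₂] [Module ℂ E₂] [AddCommGroup E₃] [Module ℂ E₃]
    (c₁ : H₁ → E₁) (c₂ : H₂ → E₂) (c₃ : H₃ → E₃) (i : H₁ →* H₂) (p : H₂ →* H₃) : Prop where
  alg₁ : IsAffineAlgebraicGroup c₁
  alg₂ : IsAffineAlgebraicGroup c₂
  alg₃ : IsAffineAlgebraicGroup c₃
  regular_i : IsRegularMap c₁ c₂ i
  regular_p : IsRegularMap c₂ c₃ p
  injective : Function.Injective i
  exact : i.range = p.ker
  surjective : Function.Surjective p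

end AlgebraicGroups

/-! ### Classical spaces with signature -/

/-- The labels `B, C, D, C̃, C*, D*`. -/
inductive ClassicalType
  | B | C | D | Ctilde | Cstar | Dstar

namespace ClassicalType

/-- The sign `ε` of the bilinear form: symmetric for `B, D, D*`, skew-symmetric otherwise. -/
def eps : ClassicalType → ℂ
  | B => 1
  | D => 1
  | Dstar => 1
  | C => -1
  | Ctilde => -1
  | Cstar => -1

/-- The sign `ε̇`, the square of `L`. -/
def epsDot : ClassicalType → ℂ
  | B => 1
  | D => 1
  | Cstar => 1
  | C => -1
  | Ctilde => -1
  | Dstar => -1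

lemma epsDot_mul_self (t : ClassicalType) : t.epsDot * t.epsDot = 1 := by
  cases t <;> simp [epsDot]

end ClassicalType

/-- A classical signature `(⋆, p, q)`. -/
structure ClassicalSignature where
  star : ClassicalType
  p : ℕ
  q : ℕ
  valid : match star with
    | .B => Odd (p + q)
    | .D => Even (p + q)
    | .C => p = q
    | .Ctilde => p = q
    | .Dstar => p = q
    | .Cstar => Even p ∧ Even q

/-- A classical space `(V, ⟨ , ⟩, J, L)` of signature `s`. -/
structure ClassicalSpace (s : ClassicalSignature) (V : Type*) [AddCommGroup V] [Module ℂ V] where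
  form : LinearMap.BilinForm ℂ V
  form_nondegenerate : form.Nondegenerate
  form_symm : ∀ u v, form u v = s.star.eps * form v u
  /-- the real or quaternionic structure -/
  J : V →ₛₗ[starRingEnd ℂ] V
  J_sq : ∀ v, J (J v) = (s.star.eps * s.star.epsDot) • v
  form_J : ∀ u v, form (J u) (J v) = starRingEnd ℂ (form u v)
  /-- the automorphism fixing the maximal compact subgroup -/
  L : V →ₗ[ℂ] V
  L_sq : ∀ v, L (L v) = s.star.epsDot • v
  form_L : ∀ u v, form (L u) (L v) = form u v
  L_J : ∀ v, L (J v) = J (L v)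
  /-- the Hermitian form `(u, v) ↦ ⟨L u, J v⟩` is positive definite -/
  pos : ∀ u, u ≠ 0 → 0 < (form (L u) (J u)).re
  finrank_eq : finrank ℂ V = s.p + s.q
  finrank_eigenspace : s.star.epsDot = 1 →
    finrank ℂ (End.eigenspace L 1) = s.p ∧ finrank ℂ (End.eigenspace L (-1)) = s.q

namespace ClassicalSpace

section OneSpace

variable {s : ClassicalSignature} {V : Type*} [AddCommGroup V] [Module ℂ V]

/-- The isometry group `𝐆` of `(V, ⟨ , ⟩)`. -/
def isometryGroup (S : ClassicalSpace s V) : Subgroup (V ≃ₗ[ℂ] V) where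
  carrier := {g | ∀ u v, S.form (g u) (g v) = S.form u v}
  one_mem' := fun _ _ => rfl
  mul_mem' := by
    intro a b ha hb u v
    simp only [LinearEquiv.mul_apply]
    rw [ha, hb]
  inv_mem' := by
    intro a ha u v
    have h := ha (a⁻¹ u) (a⁻¹ v)
    have e : ∀ x, a (a⁻¹ x) = x := fun x => a.apply_symm_apply x
    rw [e, e] at h
    exact h.symm

/-- The centralizer `𝐆^L` of `L` in `𝐆`. -/
def isometryGroupL (S : ClassicalSpace s V) : Subgroup (V ≃ₗ[ℂ] V) where
  carrier := {g | g ∈ S.isometryGroup ∧ ∀ v, g (S.L v) = S.L (g v)}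
  one_mem' := ⟨one_mem _, fun _ => rfl⟩
  mul_mem' := by
    intro a b ha hb
    refine ⟨mul_mem ha.1 hb.1, fun v => ?_⟩
    simp only [LinearEquiv.mul_apply]
    rw [hb.2, ha.2]
  inv_mem' := by
    intro a ha
    refine ⟨inv_mem ha.1, fun v => ?_⟩
    have e : ∀ x, a (a⁻¹ x) = x := fun x => a.apply_symm_apply x
    apply a.injective
    rw [e, ha.2, e]

lemma isometryGroupL_comm (S : ClassicalSpace s V) (g : S.isometryGroupL) (v : V) :
    (g : V ≃ₗ[ℂ] V) (S.L v) = S.L ((g : V ≃ₗ[ℂ] V) v) := g.2.2 v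

lemma isometryGroupL_form (S : ClassicalSpace s V) (g : S.isometryGroupL) (u v : V) :
    S.form ((g : V ≃ₗ[ℂ] V) u) ((g : V ≃ₗ[ℂ] V) v) = S.form u v := g.2.1 u v

/-- The action of `𝐆^L` on the `i`-eigenspace of `L`. -/
def resI (S : ClassicalSpace s V) :
    S.isometryGroupL →* End ℂ (End.eigenspace S.L Complex.I) where
  toFun g := LinearMap.restrict ((g : V ≃ₗ[ℂ] V) : V →ₗ[ℂ] V) (p := End.eigenspace S.L Complex.I)
    (q := End.eigenspace S.L Complex.I) (by
      intro v hv
      rw [End.mem_eigenspace_iff] at hv ⊢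
      rw [LinearEquiv.coe_coe, ← S.isometryGroupL_comm, hv, map_smul])
  map_one' := by ext v; rfl
  map_mul' := by intro a b; ext v; rfl

/-- The group `𝐊`, the complexification of a maximal compact subgroup `K` of the real classical
group `G` of signature `s`, realized inside `𝐆^L × ℂˣ`.
If `⋆ ≠ C̃`, then `𝐊 = 𝐆^L`. If `⋆ = C̃`, then `𝐆^L` is identified with `GL_p(ℂ)` by its action on
the `i`-eigenspace of `L`, and `K` is the inverse image of `U(p)` in the metaplectic group, so
that `𝐊` is the double cover `{(g, t) | t ^ 2 = det g}` of `GL_p(ℂ)`. -/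
def complexK (S : ClassicalSpace s V) : Subgroup (S.isometryGroupL × ℂˣ) where
  carrier := {x | (s.star = .Ctilde → (x.2 : ℂ) ^ 2 = LinearMap.det (S.resI x.1)) ∧
    (s.star ≠ .Ctilde → x.2 = 1)}
  one_mem' := ⟨fun _ => by simp, fun _ => rfl⟩
  mul_mem' := by
    intro a b ha hb
    refine ⟨fun h => ?_, fun h => ?_⟩
    · simp only [Prod.snd_mul, Prod.fst_mul, Units.val_mul, map_mul, mul_pow, ha.1 h, hb.1 h]
    · simp [ha.2 h, hb.2 h]
  inv_mem' := by
    intro a ha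
    refine ⟨fun h => ?_, fun h => ?_⟩
    · have h1 := ha.1 h
      have h2 : LinearMap.det (S.resI a.1) * LinearMap.det (S.resI a.1⁻¹) = 1 := by
        rw [← map_mul, ← map_mul, mul_inv_cancel, map_one, map_one]
      have h3 : LinearMap.det (S.resI a.1) ≠ 0 := left_ne_zero_of_mul_eq_one h2
      simp only [Prod.snd_inv, Prod.fst_inv, Units.val_inv_eq_inv_val, inv_pow, h1]
      exact inv_eq_of_mul_eq_one_right h2
    · simp [ha.2 h]

/-- The natural homomorphism `𝐊 → 𝐆^L`. -/
def toIso (S : ClassicalSpace s V) : S.complexK →* S.isometryGroupL :=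
  (MonoidHom.fst _ _).comp S.complexK.subtype

/-- The action of an element of `𝐊` on `V`. -/
def act (S : ClassicalSpace s V) (k : S.complexK) : V →ₗ[ℂ] V :=
  ((S.toIso k : V ≃ₗ[ℂ] V) : V →ₗ[ℂ] V)

lemma act_one (S : ClassicalSpace s V) : S.act 1 = LinearMap.id := rfl

lemma act_mul (S : ClassicalSpace s V) (a b : S.complexK) :
    S.act (a * b) = S.act a ∘ₗ S.act b := rfl

lemma act_act_inv (S : ClassicalSpace s V) (a : S.complexK) (v : V) :
    S.act a (S.act a⁻¹ v) = v := by
  rw [← LinearMap.comp_apply, ← act_mul, mul_inv_cancel, act_one, LinearMap.id_apply]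

lemma act_inv_act (S : ClassicalSpace s V) (a : S.complexK) (v : V) :
    S.act a⁻¹ (S.act a v) = v := by
  rw [← LinearMap.comp_apply, ← act_mul, inv_mul_cancel, act_one, LinearMap.id_apply]

lemma act_L (S : ClassicalSpace s V) (a : S.complexK) (v : V) :
    S.act a (S.L v) = S.L (S.act a v) := S.isometryGroupL_comm _ v

lemma form_act (S : ClassicalSpace s V) (a : S.complexK) (u v : V) :
    S.form (S.act a u) (S.act a v) = S.form u v := S.isometryGroupL_form _ u v

lemma form_act_left (S : ClassicalSpace s V) (a : S.complexK) (u v : V) :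
    S.form (S.act a u) v = S.form u (S.act a⁻¹ v) := by
  rw [← S.form_act a u, act_act_inv]

/-- Coordinates on `𝐊`: matrix entries of `g` and `g⁻¹`, and `t`, `t⁻¹`. -/
def coord (S : ClassicalSpace s V) (k : S.complexK) : (End ℂ V × End ℂ V) × (ℂ × ℂ) :=
  ((S.act k, S.act k⁻¹), ((k.1.2 : ℂ), ((k⁻¹).1.2 : ℂ)))

/-- The space `𝔭`: elements of the Lie algebra `𝔤` of `𝐆` on which conjugation by `L` is `-1`. -/
def pSpace (S : ClassicalSpace s V) : Submodule ℂ (End ℂ V) where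
  carrier := {X | (∀ u v, S.form (X u) v = -S.form u (X v)) ∧ ∀ v, S.L (X v) = -X (S.L v)}
  zero_mem' := by simp
  add_mem' := by
    intro X Y hX hY
    refine ⟨fun u v => ?_, fun v => ?_⟩
    · simp only [LinearMap.add_apply, map_add, hX.1, hY.1]; ring
    · simp only [LinearMap.add_apply, map_add, hX.2, hY.2]; abel
  smul_mem' := by
    intro c X hX
    refine ⟨fun u v => ?_, fun v => ?_⟩
    · simp only [LinearMap.smul_apply, map_smul, hX.1, smul_neg]
    · simp only [LinearMap.smul_apply, map_smul, hX.2, smul_neg]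

/-- `𝐊` acts on `𝔭` by conjugation. -/
instance (S : ClassicalSpace s V) : MulAction S.complexK S.pSpace where
  smul k X := ⟨S.act k ∘ₗ (X : End ℂ V) ∘ₗ S.act k⁻¹, by
    refine ⟨fun u v => ?_, fun v => ?_⟩
    · simp only [LinearMap.comp_apply]
      rw [form_act_left, X.2.1, ← S.form_act k, act_act_inv]
    · simp only [LinearMap.comp_apply]
      rw [← act_L, X.2.2, ← act_L, map_neg]⟩
  one_smul X := by
    apply Subtype.ext
    change S.act 1 ∘ₗ (X : End ℂ V) ∘ₗ S.act 1⁻¹ = X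
    rw [inv_one, act_one]; rfl
  mul_smul a b X := by
    apply Subtype.ext
    change S.act (a * b) ∘ₗ (X : End ℂ V) ∘ₗ S.act (a * b)⁻¹ =
      S.act a ∘ₗ (S.act b ∘ₗ (X : End ℂ V) ∘ₗ S.act b⁻¹) ∘ₗ S.act a⁻¹
    rw [mul_inv_rev, act_mul, act_mul]; rfl

lemma eq_of_form_right (S : ClassicalSpace s V) {x y : V} (h : ∀ v, S.form v x = S.form v y) :
    x = y := by
  rw [← sub_eq_zero]
  refine S.form_nondegenerate.2 _ fun v => ?_
  rw [map_sub, h, sub_self]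

lemma form_L_right (S : ClassicalSpace s V) (u v : V) :
    S.form u (S.L v) = s.star.epsDot * S.form (S.L u) v := by
  rw [← S.form_L u, S.L_sq, map_smul, smul_eq_mul]

end OneSpace

section TwoSpaces

variable {s s' : ClassicalSignature} {V V' : Type*} [AddCommGroup V] [Module ℂ V]
  [FiniteDimensional ℂ V] [AddCommGroup V'] [Module ℂ V']

/-- The adjoint `φ^* : V' → V` of `φ : V → V'`, determined by `⟨φ v, v'⟩ = ⟨v, φ^* v'⟩`. -/
noncomputable def adjoint (S : ClassicalSpace s V) (S' : ClassicalSpace s' V') (φ : V →ₗ[ℂ] V') :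
    V' →ₗ[ℂ] V :=
  (LinearMap.BilinForm.toDual S.form.flip S.form_nondegenerate.flip).symm.toLinearMap ∘ₗ
    φ.dualMap ∘ₗ S'.form.flip

lemma form_adjoint (S : ClassicalSpace s V) (S' : ClassicalSpace s' V') (φ : V →ₗ[ℂ] V') (v : V)
    (v' : V') : S.form v (S.adjoint S' φ v') = S'.form (φ v) v' :=
  LinearMap.BilinForm.apply_toDual_symm_apply (B := S.form.flip)
    (hB := S.form_nondegenerate.flip) (φ.dualMap (S'.form.flip v')) v

/-- The eigenspace `𝒳` of `𝒲 = Hom(V, V')` for the eigenvalue `ι`, a chosen square root of `-1`: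
`φ ∈ 𝒳` if and only if `L φ^* = ι ε̇ φ^* L'`. -/
noncomputable def xSpace (S : ClassicalSpace s V) (S' : ClassicalSpace s' V') (ι : ℂ) :
    Submodule ℂ (V →ₗ[ℂ] V') where
  carrier := {φ | ∀ v', S.L (S.adjoint S' φ v') =
    (ι * s.star.epsDot) • S.adjoint S' φ (S'.L v')}
  zero_mem' := by
    intro v'
    have h : S.adjoint S' 0 = 0 := by
      ext w
      apply S.eq_of_form_right
      intro v
      simp [form_adjoint]
    simp [h]
  add_mem' := by
    intro a b ha hb v'
    have h : S.adjoint S' (a + b) = S.adjoint S' a + S.adjoint S' b := by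
      ext w
      apply S.eq_of_form_right
      intro v
      simp [form_adjoint]
    simp only [h, LinearMap.add_apply, map_add, smul_add, ha v', hb v']
  smul_mem' := by
    intro c a ha v'
    have h : S.adjoint S' (c • a) = c • S.adjoint S' a := by
      ext w
      apply S.eq_of_form_right
      intro v
      simp [form_adjoint]
    simp only [h, LinearMap.smul_apply, map_smul, ha v']
    rw [smul_comm]

lemma adjoint_act (S : ClassicalSpace s V) (S' : ClassicalSpace s' V') (k : S.complexK)
    (k' : S'.complexK) (φ : V →ₗ[ℂ] V') :
    S.adjoint S' (S'.act k' ∘ₗ φ ∘ₗ S.act k⁻¹) =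
      S.act k ∘ₗ S.adjoint S' φ ∘ₗ S'.act k'⁻¹ := by
  ext w
  apply S.eq_of_form_right
  intro v
  simp only [form_adjoint, LinearMap.comp_apply, form_act_left]
  rw [← form_adjoint, form_act_left, inv_inv]

/-- `𝐊 × 𝐊'` acts on `𝒳` by `(k, k') • φ = k' φ k⁻¹`. -/
noncomputable instance (S : ClassicalSpace s V) (S' : ClassicalSpace s' V') (ι : ℂ) :
    MulAction (S.complexK × S'.complexK) (S.xSpace S' ι) where
  smul k φ := ⟨S'.act k.2 ∘ₗ (φ : V →ₗ[ℂ] V') ∘ₗ S.act k.1⁻¹, by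
    intro v'
    rw [adjoint_act]
    simp only [LinearMap.comp_apply]
    rw [← act_L, φ.2, ← act_L, map_smul]⟩
  one_smul φ := by
    apply Subtype.ext
    change S'.act 1 ∘ₗ (φ : V →ₗ[ℂ] V') ∘ₗ S.act 1⁻¹ = φ
    rw [inv_one, act_one, act_one]; rfl
  mul_smul a b φ := by
    apply Subtype.ext
    change S'.act (a.2 * b.2) ∘ₗ (φ : V →ₗ[ℂ] V') ∘ₗ S.act (a.1 * b.1)⁻¹ =
      S'.act a.2 ∘ₗ (S'.act b.2 ∘ₗ (φ : V →ₗ[ℂ] V') ∘ₗ S.act b.1⁻¹) ∘ₗ S.act a.1⁻¹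
    rw [mul_inv_rev, act_mul, act_mul]; rfl

/-- The action of `𝐊` alone on `𝒳`, through `k ↦ (k, 1)`. -/
noncomputable instance (S : ClassicalSpace s V) (S' : ClassicalSpace s' V') (ι : ℂ) :
    MulAction S.complexK (S.xSpace S' ι) :=
  MulAction.compHom _ (MonoidHom.inl S.complexK S'.complexK)

/-- `𝒳^su`: those `φ ∈ 𝒳` for which `⟨ , ⟩` is non-degenerate on the image of `φ^*`. -/
def xSu (S : ClassicalSpace s V) (S' : ClassicalSpace s' V') (ι : ℂ) : Set (S.xSpace S' ι) :=
  {φ | LinearMap.BilinForm.Nondegenerate (S.form.restrict (LinearMap.range (S.adjoint S' (φ : V →ₗ[ℂ] V'))))}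

end TwoSpaces

end ClassicalSpace

/-- The data of a dual pair: two classical spaces over the same real division algebra
(`J ^ 2 = J' ^ 2`) with forms of opposite symmetry, together with a choice `ι` of a square root
of `-1`. -/
structure DualPair (s s' : ClassicalSignature) (V V' : Type*) [AddCommGroup V] [Module ℂ V]
    [AddCommGroup V'] [Module ℂ V'] where
  left : ClassicalSpace s V
  right : ClassicalSpace s' V'
  eps_opp : s'.star.eps = -s.star.eps
  epsDot_opp : s'.star.epsDot = -s.star.epsDot
  ι : ℂ
  ι_sq : ι ^ 2 = -1

namespace DualPair

variable {s s' : ClassicalSignature} {V V' : Type*} [AddCommGroup V] [Module ℂ V]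
  [FiniteDimensional ℂ V] [AddCommGroup V'] [Module ℂ V']

/-- The group `𝐊`. -/
abbrev K (P : DualPair s s' V V') := P.left.complexK

/-- The group `𝐊'`. -/
abbrev K' (P : DualPair s s' V V') := P.right.complexK

/-- The space `𝔭'`. -/
abbrev p' (P : DualPair s s' V V') := P.right.pSpace

/-- The space `𝒳`. -/
noncomputable abbrev X (P : DualPair s s' V V') := P.left.xSpace P.right P.ι

/-- The subset `𝒳^su` of `𝒳`. -/
abbrev Xsu (P : DualPair s s' V V') : Set P.X := P.left.xSu P.right P.ι

/-- The moment map `M' : 𝒳 → 𝔭'`, `φ ↦ φ φ^*`. -/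
noncomputable def M' (P : DualPair s s' V V') (φ : P.X) : P.p' :=
  ⟨(φ : V →ₗ[ℂ] V') ∘ₗ P.left.adjoint P.right φ, by
    have hι : P.ι * P.ι = -1 := by rw [← sq]; exact P.ι_sq
    have hd := s.star.epsDot_mul_self
    have he : s.star.eps * s.star.eps = 1 := by cases s.star <;> simp [ClassicalType.eps]
    refine ⟨fun u v => ?_, fun v => ?_⟩
    · simp only [LinearMap.comp_apply]
      rw [← P.left.form_adjoint P.right, P.right.form_symm u, ← P.left.form_adjoint P.right,
        P.left.form_symm, P.eps_opp]
      ring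
    · apply P.right.eq_of_form_right
      intro w
      have key : ∀ u x, P.right.form u ((φ : V →ₗ[ℂ] V') x) =
          -P.left.form (P.left.adjoint P.right φ u) x := by
        intro u x
        rw [P.right.form_symm, ← P.left.form_adjoint P.right, P.left.form_symm, P.eps_opp,
          ← mul_assoc, neg_mul, he, neg_one_mul]
      have hL : ∀ v', P.left.adjoint P.right φ (P.right.L v') =
          (-(P.ι * s.star.epsDot)) • P.left.L (P.left.adjoint P.right φ v') := by
        intro v'
        rw [φ.2 v', smul_smul]
        have : -(P.ι * s.star.epsDot) * (P.ι * s.star.epsDot) = 1 := by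
          linear_combination (-(s.star.epsDot * s.star.epsDot)) * hι + hd
        rw [this, one_smul]
      simp only [LinearMap.comp_apply]
      rw [P.right.form_L_right, key, map_neg, key, hL, hL, map_smul, map_smul,
        P.left.form_L_right, P.epsDot_opp, LinearMap.smul_apply, smul_eq_mul, smul_eq_mul]
      ring⟩

lemma M'_smul (P : DualPair s s' V V') (x : P.K × P.K') (φ : P.X) :
    P.M' (x • φ) = x.2 • P.M' φ := by
  apply Subtype.ext
  change (P.right.act x.2 ∘ₗ (φ : V →ₗ[ℂ] V') ∘ₗ P.left.act x.1⁻¹) ∘ₗ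
    P.left.adjoint P.right (P.right.act x.2 ∘ₗ (φ : V →ₗ[ℂ] V') ∘ₗ P.left.act x.1⁻¹) =
    P.right.act x.2 ∘ₗ ((φ : V →ₗ[ℂ] V') ∘ₗ P.left.adjoint P.right φ) ∘ₗ P.right.act x.2⁻¹
  rw [ClassicalSpace.adjoint_act]
  ext v
  simp only [LinearMap.comp_apply, ClassicalSpace.act_inv_act]

/-- Coordinates on `𝐊 × 𝐊'`. -/
def coordProd (P : DualPair s s' V V') (x : P.K × P.K') :
    ((End ℂ V × End ℂ V) × (ℂ × ℂ)) × ((End ℂ V' × End ℂ V') × (ℂ × ℂ)) :=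
  (P.left.coord x.1, P.right.coord x.2)

/-- The inclusion `𝐊_φ → (𝐊 × 𝐊')_φ`, `k ↦ (k, 1)`. -/
noncomputable def stabIncl (P : DualPair s s' V V') (φ : P.X) :
    MulAction.stabilizer P.K φ →* MulAction.stabilizer (P.K × P.K') φ where
  toFun k := ⟨((k : P.K), 1), k.2⟩
  map_one' := rfl
  map_mul' a b := by
    apply Subtype.ext
    simp

/-- The projection to the second factor `(𝐊 × 𝐊')_φ → 𝐊'_{e'}`, where `e' = M'(φ)`. -/
noncomputable def stabProj (P : DualPair s s' V V') (φ : P.X) :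
    MulAction.stabilizer (P.K × P.K') φ →* MulAction.stabilizer P.K' (P.M' φ) where
  toFun x := ⟨(x : P.K × P.K').2, by
    have h : (x : P.K × P.K') • φ = φ := x.2
    rw [MulAction.mem_stabilizer_iff, ← M'_smul, h]⟩
  map_one' := rfl
  map_mul' _ _ := rfl

end DualPair

/-! ### Square roots of invertible operators -/

section SquareRoot

open Polynomial

/-! Everything rests on the identity `⟨φ^* u, φ^* v⟩ = ⟨M'(φ) u, v⟩` (`form_adjoint_adjoint`): the
moment map records exactly the form pulled back to `V'` along `φ^*`. Hence `φ^*` maps `ker M'(φ)`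
onto the radical of the form on `Im φ^*`, and `φ` lies in `𝒳^su` exactly when `ker φ^* = ker M'(φ)`.

Non-emptiness: `Im φ^*` is `L`-stable, and `L` is semisimple because its square is a non-zero
scalar. The radical of `Im φ^*` therefore has an `L`-stable complement in it. Composing `φ` with the
orthogonal projection onto that complement discards only the radical, so `M'` is unchanged
(`exists_mem_Xsu_M'_eq`).

Uniqueness: if `φ, ψ ∈ 𝒳^su` have the same image under `M'`, then `φ^* u ↦ ψ^* u` is a well-defined
`L`-equivariant isometry between non-degenerate subspaces. An equivariant Witt theorem
(`exists_isometry_extending`) extends it to an element of `𝐆^L`, which lifts to `𝐊`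
(`exists_smul_eq_of_M'_eq`). The extension is first chosen merely equivariant and then made
isometric by dividing by a square root of `T^* T` that is a polynomial in `T^* T`.

Both claims about orbits follow. In the sequence of stabilizers only surjectivity has content: for
`k'` fixing `e'`, the points `(1, k') • φ` and `φ` have the same image under `M'`, so some `k` gives
`(k, k') • φ = φ`. The groups are algebraic because polynomial equations in the coordinates cut them
out. -/

lemma Polynomial.exists_dvd_sq_sub_X {K : Type*} [Field K] [IsAlgClosed K] [CharZero K] {q : K[X]}
    (hq : q.eval 0 ≠ 0) : ∃ p : K[X], q ∣ p ^ 2 - X := by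
  classical
  have hq0 : q ≠ 0 := by rintro rfl; simp at hq
  choose r hr using fun z : K => IsAlgClosed.exists_pow_nat_eq z (n := 2) two_pos
  -- Interpolating square roots at the roots of `q` solves the congruence up to nilpotents; Newton
  -- iteration in `K[X]/(q)` then makes it exact.
  set p₀ : K[X] := Lagrange.interpolate q.roots.toFinset id r with hp₀
  have hroot : ∀ z ∈ q.roots, (X - C z) ∣ p₀ ^ 2 - X := by
    intro z hz
    rw [dvd_iff_isRoot, IsRoot.def, eval_sub, eval_pow, eval_X]
    have := Lagrange.eval_interpolate_at_node (s := q.roots.toFinset) (v := id) r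
      (Set.injOn_id _) (Multiset.mem_toFinset.2 hz)
    simp only [id] at this
    rw [hp₀, this, hr, sub_self]
  have hdvd : q ∣ (p₀ ^ 2 - X) ^ Multiset.card q.roots := by
    have hs := (IsAlgClosed.splits q).eq_prod_roots
    have h1 : (q.roots.map fun z => X - C z).prod ∣
        (q.roots.map fun _ => p₀ ^ 2 - X).prod :=
      Multiset.prod_dvd_prod_of_dvd _ _ hroot
    rw [Multiset.map_const', Multiset.prod_replicate] at h1
    have hu : IsUnit (C q.leadingCoeff) :=
      isUnit_C.2 (isUnit_iff_ne_zero.2 (leadingCoeff_ne_zero.2 hq0))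
    rw [hs, hu.mul_left_dvd]
    rwa [← hs]
  have hnil : IsNilpotent (AdjoinRoot.mk q (p₀ ^ 2 - X)) :=
    ⟨_, by rw [← map_pow]; exact AdjoinRoot.mk_eq_zero.2 hdvd⟩
  have hXunit : IsUnit (AdjoinRoot.mk q X) := by
    have hc : IsCoprime (X : K[X]) q := by
      refine (irreducible_X.coprime_iff_not_dvd).2 ?_
      rwa [X_dvd_iff, coeff_zero_eq_eval_zero]
    obtain ⟨a, b, hab⟩ := hc
    refine IsUnit.of_mul_eq_one (AdjoinRoot.mk q a) ?_
    have := congrArg (AdjoinRoot.mk q) hab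
    simpa [mul_comm] using this
  -- Modulo `q`, `p₀ ^ 2` is a unit plus a nilpotent. So the derivative `2 p₀` of `Y ^ 2 - X` at
  -- `p₀` is invertible, as the lifting requires.
  have hsq : IsUnit (AdjoinRoot.mk q p₀) := by
    have : IsUnit (AdjoinRoot.mk q (p₀ ^ 2 - X) + AdjoinRoot.mk q X) :=
      hnil.isUnit_add_right_of_commute hXunit (Commute.all _ _)
    rw [← map_add, sub_add_cancel, map_pow] at this
    exact (isUnit_pow_iff two_ne_zero).1 this
  have htwo : IsUnit (2 : AdjoinRoot q) := by
    have := (isUnit_iff_ne_zero.2 (two_ne_zero : (2 : K) ≠ 0)).map (algebraMap K (AdjoinRoot q))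
    rwa [map_ofNat] at this
  obtain ⟨y, ⟨-, hy⟩, -⟩ := existsUnique_nilpotent_sub_and_aeval_eq_zero
    (P := (X ^ 2 - C (AdjoinRoot.mk q X) : (AdjoinRoot q)[X])) (x := AdjoinRoot.mk q p₀)
    (by simpa using hnil) (by simpa [one_add_one_eq_two] using And.intro htwo hsq)
  obtain ⟨p, rfl⟩ := AdjoinRoot.mk_surjective y
  refine ⟨p, AdjoinRoot.mk_eq_zero.1 ?_⟩
  simpa using hy

lemma Polynomial.exists_dvd_sq_sub_X_and_eval_one {K : Type*} [Field K] [IsAlgClosed K]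
    [CharZero K] {q : K[X]} (hq : q.eval 0 ≠ 0) : ∃ p : K[X], q ∣ p ^ 2 - X ∧ p.eval 1 = 1 := by
  -- The extra factor `X - 1` forces `p(1) = ±1`; multiplying `p` by this sign normalizes it.
  obtain ⟨p, hp⟩ := exists_dvd_sq_sub_X (q := q * (X - C 1)) (by simpa using hq)
  have h1 : p.eval 1 ^ 2 = 1 := by
    have : (p ^ 2 - X).IsRoot 1 := dvd_iff_isRoot.1 ((dvd_mul_left _ _).trans hp)
    simpa [sub_eq_zero] using this
  refine ⟨C (p.eval 1) * p, ?_, ?_⟩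
  · rw [mul_pow, ← C_pow, h1, C_1, one_mul]
    exact (dvd_mul_right _ _).trans hp
  · rw [eval_mul, eval_C, ← sq, h1]

/-- An injective operator has a square root which is a polynomial in it, and for which the
polynomial can be chosen to fix `1`. -/
lemma Module.End.exists_aeval_sq_eq {K V : Type*} [Field K] [IsAlgClosed K] [CharZero K]
    [AddCommGroup V] [Module K V] [FiniteDimensional K V] {A : End K V}
    (hA : Function.Injective A) : ∃ p : K[X], aeval A p ^ 2 = A ∧ p.eval 1 = 1 := by
  have hq : (minpoly K A).eval 0 ≠ 0 := by
    intro h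
    have h0 : A.HasEigenvalue 0 := End.hasEigenvalue_of_isRoot h
    obtain ⟨v, hv⟩ := h0.exists_hasEigenvector
    refine hv.2 (hA ?_)
    rw [hv.apply_eq_smul, zero_smul, map_zero]
  obtain ⟨p, ⟨r, hr⟩, hp⟩ := exists_dvd_sq_sub_X_and_eval_one hq
  refine ⟨p, ?_, hp⟩
  have := congrArg (aeval A) hr
  rw [map_mul, minpoly.aeval, zero_mul, map_sub, map_pow, aeval_X, sub_eq_zero] at this
  exact this

end SquareRoot

/-! ### Operators whose square is a scalar -/

section ScalarSquare

variable {K V : Type*} [Field K] [AddCommGroup V] [Module K V]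

/-- `L` is annihilated by `X ^ 2 - d`, which is separable since `2` and `d` are non-zero; hence `L`
is semisimple. -/
lemma exists_isCompl_of_sq_eq_smul [NeZero (2 : K)] [FiniteDimensional K V] {L : V →ₗ[K] V} {d : K}
    (hd : d ≠ 0) (hL : ∀ v, L (L v) = d • v) {p : Submodule K V} (hp : ∀ v ∈ p, L v ∈ p) :
    ∃ q : Submodule K V, (∀ v ∈ q, L v ∈ q) ∧ IsCompl p q := by
  have hss : End.IsSemisimple (L : End K V) := by
    refine End.isSemisimple_of_squarefree_aeval_eq_zero (p := Polynomial.X ^ 2 - Polynomial.C d)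
      (Polynomial.separable_X_pow_sub_C d (n := 2) (by exact_mod_cast NeZero.ne (2 : K)) hd).squarefree
      ?_
    ext v
    simp [sq, hL, Algebra.algebraMap_eq_smul_one]
  obtain ⟨q, hq, hpq⟩ := End.isSemisimple_iff.1 hss p hp
  exact ⟨q, hq, hpq⟩

/-- The components of an eigenvector along invariant complements are eigenvectors, so the eigenspace
splits along `p` and `q`. -/
lemma finrank_inf_eigenspace_add [FiniteDimensional K V] {L : End K V} {p q : Submodule K V}
    (hp : ∀ v ∈ p, L v ∈ p) (hq : ∀ v ∈ q, L v ∈ q) (hpq : IsCompl p q) (c : K) :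
    finrank K ↥(p ⊓ End.eigenspace L c) + finrank K ↥(q ⊓ End.eigenspace L c) =
      finrank K (End.eigenspace L c) := by
  have hsup : (p ⊓ End.eigenspace L c) ⊔ (q ⊓ End.eigenspace L c) = End.eigenspace L c := by
    refine le_antisymm (sup_le inf_le_right inf_le_right) fun x hx => ?_
    have hx' := End.mem_eigenspace_iff.1 hx
    obtain ⟨u, hu, w, hw, rfl⟩ :=
      Submodule.mem_sup.1 (hpq.sup_eq_top ▸ Submodule.mem_top : x ∈ p ⊔ q)
    have h : L u - c • u = c • w - L w := by
      rw [map_add, smul_add] at hx'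
      rw [sub_eq_sub_iff_add_eq_add, hx']; abel
    have h1 : L u - c • u ∈ p := p.sub_mem (hp u hu) (p.smul_mem c hu)
    have h2 : L u - c • u ∈ q := h ▸ q.sub_mem (q.smul_mem c hw) (hq w hw)
    have h0 : L u - c • u = 0 := by
      have : L u - c • u ∈ p ⊓ q := ⟨h1, h2⟩
      rwa [hpq.inf_eq_bot, Submodule.mem_bot] at this
    refine Submodule.add_mem_sup ⟨hu, End.mem_eigenspace_iff.2 (sub_eq_zero.1 h0)⟩
      ⟨hw, End.mem_eigenspace_iff.2 ?_⟩
    rw [h0] at h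
    exact (sub_eq_zero.1 h.symm).symm
  have hinf : (p ⊓ End.eigenspace L c) ⊓ (q ⊓ End.eigenspace L c) = ⊥ :=
    eq_bot_iff.2 ((inf_le_inf inf_le_left inf_le_left).trans hpq.inf_eq_bot.le)
  have h := Submodule.finrank_sup_add_finrank_inf_eq (p ⊓ End.eigenspace L c)
    (q ⊓ End.eigenspace L c)
  rw [hsup, hinf, finrank_bot, add_zero] at h
  exact h.symm

/-- The decomposition of an invariant subspace into eigenspaces, for an operator with square
`c ^ 2`. -/
lemma exists_eigenDecomposition [NeZero (2 : K)] {L : End K V} {c : K} (hc : c ≠ 0)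
    (hL : ∀ v, L (L v) = (c * c) • v) {q : Submodule K V} (hq : ∀ v ∈ q, L v ∈ q) :
    ∃ D : (↥(q ⊓ End.eigenspace L c) × ↥(q ⊓ End.eigenspace L (-c))) ≃ₗ[K] q,
      ∀ a, ((D a : q) : V) = a.1 + a.2 := by
  have h2 : (2 : K) ≠ 0 := NeZero.ne _
  let D : (↥(q ⊓ End.eigenspace L c) × ↥(q ⊓ End.eigenspace L (-c))) →ₗ[K] q :=
    (Submodule.inclusion inf_le_left).coprod (Submodule.inclusion inf_le_left)
  have hD : ∀ a, ((D a : q) : V) = a.1 + a.2 := fun a => by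
    simp [D, LinearMap.coprod_apply]
  refine ⟨LinearEquiv.ofBijective D ⟨?_, ?_⟩, hD⟩
  · rw [← LinearMap.ker_eq_bot, LinearMap.ker_eq_bot']
    rintro ⟨⟨a, ha⟩, ⟨b, hb⟩⟩ hab
    have h1 : a + b = 0 := by rw [← hD ⟨⟨a, ha⟩, ⟨b, hb⟩⟩, hab]; rfl
    have ha' := End.mem_eigenspace_iff.1 ha.2
    have hb' := End.mem_eigenspace_iff.1 hb.2
    have hbn : b = -a := (neg_eq_of_add_eq_zero_right h1).symm
    have h0 : (2 * c) • a = 0 := by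
      rw [hbn, map_neg, ha', neg_smul, smul_neg, neg_neg] at hb'
      rw [two_mul, add_smul]
      nth_rw 1 [← hb']
      exact neg_add_cancel _
    have ha0 : a = 0 := (smul_eq_zero.1 h0).resolve_left (mul_ne_zero h2 hc)
    subst ha0
    simp only [neg_zero] at hbn
    subst hbn
    rfl
  · rintro ⟨v, hv⟩
    -- The eigenprojections are `(c ± L) / 2c`.
    refine ⟨⟨⟨(2 * c)⁻¹ • (c • v + L v), ?_, ?_⟩, ⟨(2 * c)⁻¹ • (c • v - L v), ?_, ?_⟩⟩, ?_⟩
    · exact q.smul_mem _ (q.add_mem (q.smul_mem _ hv) (hq v hv))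
    · refine Submodule.smul_mem _ _ (End.mem_eigenspace_iff.2 ?_)
      rw [map_add, map_smul, hL, smul_add, smul_smul, add_comm]
    · exact q.smul_mem _ (q.sub_mem (q.smul_mem _ hv) (hq v hv))
    · refine Submodule.smul_mem _ _ (End.mem_eigenspace_iff.2 ?_)
      rw [map_sub, map_smul, hL, smul_sub, smul_smul]
      module
    · apply Subtype.ext
      rw [hD, ← smul_add]
      have : c • v + L v + (c • v - L v) = (2 * c) • v := by module
      rw [this, smul_smul, inv_mul_cancel₀ (mul_ne_zero h2 hc), one_smul]

/-- Cancellation of equivariantly isomorphic direct summands. -/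
lemma exists_equivariant_equiv_compl [NeZero (2 : K)] [FiniteDimensional K V] {L : End K V} {c : K}
    (hc : c ≠ 0) (hL : ∀ v, L (L v) = (c * c) • v) {p₁ q₁ p₂ q₂ : Submodule K V}
    (hp₁ : ∀ v ∈ p₁, L v ∈ p₁) (hq₁ : ∀ v ∈ q₁, L v ∈ q₁) (hp₂ : ∀ v ∈ p₂, L v ∈ p₂)
    (hq₂ : ∀ v ∈ q₂, L v ∈ q₂) (h₁ : IsCompl p₁ q₁) (h₂ : IsCompl p₂ q₂) (g : p₁ ≃ₗ[K] p₂)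
    (hg : ∀ v : p₁, L (g v) = g ⟨L v, hp₁ v v.2⟩) :
    ∃ h : q₁ ≃ₗ[K] q₂, ∀ v : q₁, L (h v) = h ⟨L v, hq₁ v v.2⟩ := by
  -- `g` matches the eigenspaces in `p₁` and `p₂`, so subtracting from the full eigenspace matches
  -- dimensions in `q₁` and `q₂`. Arbitrary isomorphisms of the eigenspaces then suffice.
  have hfin : ∀ b : K, finrank K ↥(q₁ ⊓ End.eigenspace L b) =
      finrank K ↥(q₂ ⊓ End.eigenspace L b) := by
    intro b
    have e : finrank K ↥(p₁ ⊓ End.eigenspace L b) = finrank K ↥(p₂ ⊓ End.eigenspace L b) := by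
      have hm : (p₁ ⊓ End.eigenspace L b).comap p₁.subtype =
          ((p₂ ⊓ End.eigenspace L b).comap p₂.subtype).comap (g : p₁ →ₗ[K] p₂) := by
        ext v
        simp only [Submodule.mem_comap, Submodule.mem_inf, End.mem_eigenspace_iff,
          Submodule.subtype_apply, SetLike.coe_mem, true_and, LinearEquiv.coe_coe, hg]
        rw [← Submodule.coe_smul, ← Submodule.coe_smul, ← map_smul, Subtype.coe_inj,
          g.injective.eq_iff]
        exact ⟨fun h => Subtype.ext h, fun h => congrArg Subtype.val h⟩
      have e₁ := (Submodule.comapSubtypeEquivOfLe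
        (inf_le_left : p₁ ⊓ End.eigenspace L b ≤ p₁)).finrank_eq
      have e₂ := (Submodule.comapSubtypeEquivOfLe
        (inf_le_left : p₂ ⊓ End.eigenspace L b ≤ p₂)).finrank_eq
      rw [← e₁, ← e₂, hm]
      exact (g.ofSubmodule' _).finrank_eq
    have a₁ := finrank_inf_eigenspace_add hp₁ hq₁ h₁ b
    have a₂ := finrank_inf_eigenspace_add hp₂ hq₂ h₂ b
    omega
  obtain ⟨D₁, hD₁⟩ := exists_eigenDecomposition hc hL hq₁
  obtain ⟨D₂, hD₂⟩ := exists_eigenDecomposition hc hL hq₂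
  let f : ∀ b : K, ↥(q₁ ⊓ End.eigenspace L b) ≃ₗ[K] ↥(q₂ ⊓ End.eigenspace L b) := fun b =>
    LinearEquiv.ofFinrankEq _ _ (hfin b)
  let F := (f c).prodCongr (f (-c))
  have hLD₁ : ∀ a, (⟨L (D₁ a), hq₁ _ (D₁ a).2⟩ : q₁) = D₁ (c • a.1, (-c) • a.2) := by
    intro a
    apply Subtype.ext
    simp only [hD₁, map_add, Submodule.coe_smul]
    rw [End.mem_eigenspace_iff.1 a.1.2.2, End.mem_eigenspace_iff.1 a.2.2.2]
  refine ⟨D₁.symm.trans (F.trans D₂), fun v => ?_⟩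
  obtain ⟨a, rfl⟩ := D₁.surjective v
  rw [hLD₁]
  simp only [LinearEquiv.trans_apply, LinearEquiv.symm_apply_apply, hD₂, map_add, F,
    LinearEquiv.prodCongr_apply, map_smul, Submodule.coe_smul]
  rw [End.mem_eigenspace_iff.1 (f c a.1).2.2, End.mem_eigenspace_iff.1 (f (-c) a.2).2.2]

end ScalarSquare

/-! ### Equivariant isometries of a classical space -/

namespace ClassicalType

lemma epsDot_ne_zero (t : ClassicalType) : t.epsDot ≠ 0 := by cases t <;> simp [epsDot]

end ClassicalType

namespace ClassicalSpace

variable {s : ClassicalSignature} {V : Type*} [AddCommGroup V] [Module ℂ V]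

lemma form_isRefl (S : ClassicalSpace s V) : S.form.IsRefl := by
  intro u v h
  rw [S.form_symm, h, mul_zero]

lemma eq_of_form_left (S : ClassicalSpace s V) {x y : V} (h : ∀ v, S.form x v = S.form y v) :
    x = y :=
  S.eq_of_form_right fun v => by rw [S.form_symm, h, ← S.form_symm]

variable [FiniteDimensional ℂ V]

/-- An equivariant automorphism can be corrected to an equivariant isometry, without changing it
on a subspace on which it already is isometric. -/
lemma exists_isometry_of_equivariant (S : ClassicalSpace s V) (T : V ≃ₗ[ℂ] V)
    (hT : ∀ v, T (S.L v) = S.L (T v)) (U : Submodule ℂ V)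
    (hU : ∀ u ∈ U, ∀ v, S.form (T v) (T u) = S.form v u) :
    ∃ k : S.isometryGroupL, ∀ u ∈ U, (k : V ≃ₗ[ℂ] V) u = T u := by
  -- `A = T^* T` measures the failure of `T` to be isometric: it is self-adjoint, commutes with `L`,
  -- and is the identity on `U`.
  let A : End ℂ V := S.adjoint S (T : V →ₗ[ℂ] V) ∘ₗ (T : V →ₗ[ℂ] V)
  have hA : ∀ x y, S.form x (A y) = S.form (T x) (T y) := fun x y => by
    simp [A, form_adjoint]
  have hAinj : Function.Injective A := by
    intro x y hxy
    refine T.injective (S.eq_of_form_right fun v => ?_)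
    obtain ⟨w, rfl⟩ := T.surjective v
    rw [← hA, ← hA, hxy]
  have hAself : ∀ x y, S.form (A x) y = S.form x (A y) := by
    intro x y
    rw [S.form_symm, hA, ← S.form_symm, hA]
  have hAL : Commute A S.L := by
    refine LinearMap.ext fun y => S.eq_of_form_right fun x => ?_
    change S.form x (A (S.L y)) = S.form x (S.L (A y))
    rw [hA, hT, form_L_right, ← hT, form_L_right, hA]
  obtain ⟨p, hp, hp1⟩ := End.exists_aeval_sq_eq hAinj
  -- Being a polynomial in `A`, `C` inherits self-adjointness and commutation with `L`; `p(1) = 1`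
  -- makes it fix `U`. With `C ^ 2 = A`, the map `T C⁻¹` is the required isometry.
  set C : End ℂ V := Polynomial.aeval A p with hC
  have hCC : ∀ v, C (C v) = A v := fun v => by
    rw [← hp, sq]; rfl
  have hCinj : Function.Injective C := by
    intro x y hxy
    apply hAinj
    rw [← hCC, ← hCC, hxy]
  have hCL : Commute C S.L := by
    rw [hC, Polynomial.aeval_eq_sum_range]
    exact Commute.sum_left _ _ _ fun i _ => (hAL.pow_left i).smul_left _
  have hCself : ∀ x y, S.form (C x) y = S.form x (C y) := by
    have hpow : ∀ (n : ℕ) x y, S.form ((A ^ n) x) y = S.form x ((A ^ n) y) := by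
      intro n
      induction n with
      | zero => intro x y; rfl
      | succ n ih =>
        intro x y
        rw [pow_succ, End.mul_apply, ih, hAself, ← End.mul_apply, ← pow_succ', ← pow_succ]
    intro x y
    rw [hC, Polynomial.aeval_eq_sum_range]
    simp [LinearMap.sum_apply, hpow]
  have hCU : ∀ u ∈ U, C u = u := by
    intro u hu
    have : A u = (1 : ℂ) • u := S.eq_of_form_right fun v => by rw [hA, hU u hu, one_smul]
    rcases eq_or_ne u 0 with rfl | h0
    · rw [map_zero]
    · rw [hC, End.aeval_apply_of_hasEigenvector ⟨End.mem_eigenspace_iff.2 this, h0⟩, hp1, one_smul]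
  let Ce : V ≃ₗ[ℂ] V := LinearEquiv.ofInjectiveEndo C hCinj
  have hCe : ∀ v, C (Ce.symm v) = v := fun v => Ce.apply_symm_apply v
  refine ⟨⟨Ce.symm.trans T, ⟨fun u v => ?_, fun v => ?_⟩⟩, fun u hu => ?_⟩
  · simp only [LinearEquiv.trans_apply]
    rw [← hA, ← hCC, ← hCself, hCe, hCe]
  · simp only [LinearEquiv.trans_apply]
    rw [← hT]
    congr 1
    apply hCinj
    rw [hCe]
    have := LinearMap.congr_fun hCL.eq (Ce.symm v)
    simp only [Module.End.mul_apply] at this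
    rw [this, hCe]
  · simp only [LinearEquiv.trans_apply]
    congr 1
    apply hCinj
    rw [hCe, hCU u hu]

/-- Witt's theorem for equivariant isometries between non-degenerate invariant subspaces. -/
lemma exists_isometry_extending (S : ClassicalSpace s V) {p₁ p₂ : Submodule ℂ V}
    (hp₁ : ∀ v ∈ p₁, S.L v ∈ p₁) (hp₂ : ∀ v ∈ p₂, S.L v ∈ p₂)
    (h₁ : (S.form.restrict p₁).Nondegenerate) (h₂ : (S.form.restrict p₂).Nondegenerate)
    (g : p₁ ≃ₗ[ℂ] p₂) (hg : ∀ v : p₁, S.L (g v) = g ⟨S.L v, hp₁ v v.2⟩)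
    (hgf : ∀ u v : p₁, S.form (g u) (g v) = S.form u v) :
    ∃ k : S.isometryGroupL, ∀ u : p₁, (k : V ≃ₗ[ℂ] V) u = g u := by
  have c₁ := LinearMap.BilinForm.isCompl_orthogonal_of_restrict_nondegenerate S.form_isRefl h₁
  have c₂ := LinearMap.BilinForm.isCompl_orthogonal_of_restrict_nondegenerate S.form_isRefl h₂
  have horth : ∀ p : Submodule ℂ V, (∀ v ∈ p, S.L v ∈ p) →
      ∀ v ∈ S.form.orthogonal p, S.L v ∈ S.form.orthogonal p := by
    intro p hp v hv u hu
    change S.form u (S.L v) = 0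
    rw [form_L_right, show S.form (S.L u) v = 0 from hv _ (hp u hu), mul_zero]
  obtain ⟨c, hc⟩ := IsAlgClosed.exists_pow_nat_eq s.star.epsDot (n := 2) two_pos
  have hc0 : c ≠ 0 := by
    rintro rfl
    exact s.star.epsDot_ne_zero (by rw [← hc]; simp)
  obtain ⟨h, hh⟩ := exists_equivariant_equiv_compl hc0 (L := S.L)
    (by intro v; rw [S.L_sq, ← hc, sq]) hp₁ (horth p₁ hp₁) hp₂ (horth p₂ hp₂) c₁ c₂ g hg
  -- `h` is only equivariant, so `T = g ⊕ h` need not be isometric on the orthogonal complement. It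
  -- does preserve pairings with `p₁`, which is what the correction needs.
  let T : V ≃ₗ[ℂ] V := (Submodule.prodEquivOfIsCompl _ _ c₁).symm.trans
    ((g.prodCongr h).trans (Submodule.prodEquivOfIsCompl _ _ c₂))
  have hT : ∀ (u : p₁) (w : S.form.orthogonal p₁), T (u + w) = g u + h w := by
    intro u w
    have : (u + w : V) = Submodule.prodEquivOfIsCompl _ _ c₁ (u, w) := by simp
    rw [this]
    simp [T]
  have hTg : ∀ u : p₁, T u = g u := fun u => by simpa using hT u 0
  have hdec : ∀ v, ∃ (u : p₁) (w : S.form.orthogonal p₁), v = (u : V) + (w : V) := by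
    intro v
    obtain ⟨u, hu, w, hw, rfl⟩ := Submodule.mem_sup.1
      (c₁.sup_eq_top ▸ Submodule.mem_top : v ∈ p₁ ⊔ S.form.orthogonal p₁)
    exact ⟨⟨u, hu⟩, ⟨w, hw⟩, rfl⟩
  have hTL : ∀ v, T (S.L v) = S.L (T v) := by
    intro v
    obtain ⟨u, w, rfl⟩ := hdec v
    rw [hT, map_add S.L, map_add S.L, hg, hh, ← hT]
  have hTU : ∀ u ∈ p₁, ∀ v, S.form (T v) (T u) = S.form v u := by
    intro u hu v
    obtain ⟨x, w, rfl⟩ := hdec v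
    have hgxu := hgf x ⟨u, hu⟩
    rw [hT, hTg ⟨u, hu⟩, map_add, LinearMap.add_apply, map_add, LinearMap.add_apply, hgxu,
      S.form_symm w, S.form_symm (h w), show S.form u w = 0 from w.2 u hu,
      show S.form (g ⟨u, hu⟩) (h w) = 0 from (h w).2 _ (g _).2]
  obtain ⟨k, hk⟩ := S.exists_isometry_of_equivariant T hTL p₁ hTU
  exact ⟨k, fun u => by rw [hk u u.2, hTg]⟩

end ClassicalSpace

/-! ### Lifting to `𝐊`, and orthogonal projections -/

namespace ClassicalSpace

section

variable {s : ClassicalSignature} {V : Type*} [AddCommGroup V] [Module ℂ V]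

/-- In the metaplectic case a lift is a square root of a non-zero determinant. -/
lemma toIso_surjective (S : ClassicalSpace s V) : Function.Surjective S.toIso := by
  intro g
  by_cases h : s.star = .Ctilde
  · obtain ⟨t, ht⟩ := IsAlgClosed.exists_pow_nat_eq (LinearMap.det (S.resI g)) (n := 2) two_pos
    have hdet : LinearMap.det (S.resI g) ≠ 0 := by
      have h2 : LinearMap.det (S.resI g) * LinearMap.det (S.resI g⁻¹) = 1 := by
        rw [← map_mul, ← map_mul, mul_inv_cancel, map_one, map_one]
      exact left_ne_zero_of_mul_eq_one h2
    have ht0 : t ≠ 0 := by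
      rintro rfl
      exact hdet (by rw [← ht]; simp)
    exact ⟨⟨(g, Units.mk0 t ht0), fun _ => ht, fun h' => absurd h h'⟩, rfl⟩
  · exact ⟨⟨(g, 1), fun h' => absurd h' h, fun _ => rfl⟩, rfl⟩

lemma form_projection (S : ClassicalSpace s V) {U : Submodule ℂ V} {π : End ℂ V}
    (hπ : ∀ v, π v ∈ U) (hort : ∀ v, ∀ u ∈ U, S.form (v - π v) u = 0) (v w : V) :
    S.form (π v) w = S.form v (π w) := by
  have h1 := hort v _ (hπ w)
  have h2 := S.form_isRefl _ _ (hort w _ (hπ v))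
  rw [map_sub, LinearMap.sub_apply, sub_eq_zero] at h1
  rw [map_sub, sub_eq_zero] at h2
  rw [h1, h2]

/-- `L` preserves `U`, and preserves the form, hence also the orthogonal complement of `U`. -/
lemma projection_L (S : ClassicalSpace s V) {U : Submodule ℂ V} (hUL : ∀ u ∈ U, S.L u ∈ U)
    {π : End ℂ V} (hπ : ∀ v, π v ∈ U) (hid : ∀ u ∈ U, π u = u)
    (hort : ∀ v, ∀ u ∈ U, S.form (v - π v) u = 0) (v : V) : π (S.L v) = S.L (π v) := by
  rw [← sub_eq_zero]
  refine S.eq_of_form_left fun w => ?_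
  have hmem : π (S.L v) - S.L (π v) ∈ U := U.sub_mem (hπ _) (hUL _ (hπ v))
  rw [← hid _ hmem, S.form_projection hπ hort, map_sub, LinearMap.sub_apply,
    S.form_projection hπ hort, hid _ (hπ w), map_zero, LinearMap.zero_apply, sub_eq_zero]
  have h1 := hort v _ (hUL _ (hπ w))
  rw [map_sub, LinearMap.sub_apply, sub_eq_zero, form_L_right, form_L_right] at h1
  exact mul_left_cancel₀ s.star.epsDot_ne_zero h1

end

variable {s s' : ClassicalSignature} {V V' : Type*} [AddCommGroup V] [Module ℂ V]
  [FiniteDimensional ℂ V] [AddCommGroup V'] [Module ℂ V']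

lemma adjoint_injective (S : ClassicalSpace s V) (S' : ClassicalSpace s' V') :
    Function.Injective (S.adjoint S') := by
  intro φ ψ h
  refine LinearMap.ext fun v => S'.eq_of_form_left fun v' => ?_
  rw [← S.form_adjoint, h, form_adjoint]

/-- The orthogonal projection onto a non-degenerate subspace. -/
lemma exists_orthogonal_projection (S : ClassicalSpace s V) {U : Submodule ℂ V}
    (hU : (S.form.restrict U).Nondegenerate) :
    ∃ π : End ℂ V, (∀ v, π v ∈ U) ∧ (∀ u ∈ U, π u = u) ∧
      ∀ v, ∀ u ∈ U, S.form (v - π v) u = 0 := by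
  have c := LinearMap.BilinForm.isCompl_orthogonal_of_restrict_nondegenerate S.form_isRefl hU
  refine ⟨U.subtype ∘ₗ U.projectionOnto _ c, fun v => Submodule.coe_mem _, fun u hu => ?_,
    fun v u hu => ?_⟩
  · exact congrArg Subtype.val (Submodule.projectionOnto_apply_left c ⟨u, hu⟩)
  · have h : v - U.projectionOnto _ c v ∈ LinearMap.ker (U.projectionOnto _ c) := by
      rw [LinearMap.mem_ker, map_sub, Submodule.projectionOnto_apply_left, sub_self]
    rw [Submodule.ker_projectionOnto] at h
    exact S.form_isRefl _ _ (h u hu)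

end ClassicalSpace

/-! ### Fibres of the moment map on `𝒳^su` -/

namespace DualPair

variable {s s' : ClassicalSignature} {V V' : Type*} [AddCommGroup V] [Module ℂ V]
  [FiniteDimensional ℂ V] [AddCommGroup V'] [Module ℂ V']

lemma form_adjoint_adjoint (P : DualPair s s' V V') (φ : P.X) (u v : V') :
    P.left.form (P.left.adjoint P.right φ u) (P.left.adjoint P.right φ v) =
      P.right.form ((P.M' φ : End ℂ V') u) v :=
  P.left.form_adjoint P.right φ _ v

/-- A vector `φ^* u` is in the radical of the form on `Im φ^*` exactly when `M'(φ) u = 0`, by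
`form_adjoint_adjoint` and non-degeneracy on `V'`. -/
lemma mem_Xsu_iff (P : DualPair s s' V V') (φ : P.X) :
    φ ∈ P.Xsu ↔ ∀ u, (P.M' φ : End ℂ V') u = 0 → P.left.adjoint P.right φ u = 0 := by
  constructor
  · intro h u hu
    have := h.1 ⟨_, LinearMap.mem_range_self (P.left.adjoint P.right (φ : V →ₗ[ℂ] V')) u⟩ ?_
    · exact congrArg Subtype.val this
    · rintro ⟨_, v, rfl⟩
      refine (P.form_adjoint_adjoint φ u v).trans ?_
      rw [hu, map_zero, LinearMap.zero_apply]
  · intro h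
    have key : ∀ u, (∀ v, P.left.form (P.left.adjoint P.right φ u)
        (P.left.adjoint P.right φ v) = 0) → P.left.adjoint P.right φ u = 0 := by
      intro u hu
      refine h u (P.right.eq_of_form_left fun v => ?_)
      rw [← form_adjoint_adjoint, hu, map_zero, LinearMap.zero_apply]
    refine ⟨?_, ?_⟩
    · rintro ⟨_, u, rfl⟩ hu
      exact Subtype.ext (key u fun v => hu ⟨_, v, rfl⟩)
    · rintro ⟨_, u, rfl⟩ hu
      exact Subtype.ext (key u fun v => P.left.form_isRefl _ _ (hu ⟨_, v, rfl⟩))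

lemma adjoint_smul (P : DualPair s s' V V') (x : P.K × P.K') (φ : P.X) :
    P.left.adjoint P.right (x • φ : P.X) =
      P.left.act x.1 ∘ₗ P.left.adjoint P.right φ ∘ₗ P.right.act x.2⁻¹ :=
  P.left.adjoint_act P.right x.1 x.2 φ

lemma smul_mem_Xsu (P : DualPair s s' V V') (x : P.K × P.K') {φ : P.X} (hφ : φ ∈ P.Xsu) :
    x • φ ∈ P.Xsu := by
  rw [mem_Xsu_iff] at hφ ⊢
  intro u hu
  have hu' : P.right.act x.2 ((P.M' φ : End ℂ V') (P.right.act x.2⁻¹ u)) = 0 := by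
    rw [M'_smul] at hu
    exact hu
  have h0 := congrArg (P.right.act x.2⁻¹) hu'
  rw [P.right.act_inv_act, map_zero] at h0
  rw [adjoint_smul, LinearMap.comp_apply, LinearMap.comp_apply, hφ _ h0, map_zero]

/-- The scalar is the same for every element of `𝒳`, which makes maps `φ^* u ↦ ψ^* u` automatically
`L`-equivariant. -/
lemma L_adjoint (P : DualPair s s' V V') (φ : P.X) (v : V') :
    P.left.L (P.left.adjoint P.right φ v) =
      P.left.adjoint P.right φ ((P.ι * s.star.epsDot) • P.right.L v) := by
  rw [map_smul]
  exact φ.2 v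

lemma L_mem_range_adjoint (P : DualPair s s' V V') (φ : P.X) :
    ∀ v ∈ LinearMap.range (P.left.adjoint P.right φ),
      P.left.L v ∈ LinearMap.range (P.left.adjoint P.right φ) := by
  rintro _ ⟨v, rfl⟩
  exact ⟨_, (P.L_adjoint φ v).symm⟩

/-- Elements of `𝒳^su` with the same image under `M'` are conjugate under `𝐊`. -/
lemma exists_smul_eq_of_M'_eq [FiniteDimensional ℂ V'] (P : DualPair s s' V V') {φ ψ : P.X}
    (hφ : φ ∈ P.Xsu) (hψ : ψ ∈ P.Xsu) (h : P.M' φ = P.M' ψ) :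
    ∃ k : P.K, ((k, 1) : P.K × P.K') • φ = ψ := by
  set a := P.left.adjoint P.right φ with ha
  set b := P.left.adjoint P.right ψ with hb
  have hkera : ∀ u, a u = 0 ↔ (P.M' φ : End ℂ V') u = 0 := fun u =>
    ⟨fun h0 => by change (φ : V →ₗ[ℂ] V') (a u) = 0; rw [h0, map_zero], (P.mem_Xsu_iff φ).1 hφ u⟩
  have hkerb : ∀ u, b u = 0 ↔ (P.M' ψ : End ℂ V') u = 0 := fun u =>
    ⟨fun h0 => by change (ψ : V →ₗ[ℂ] V') (b u) = 0; rw [h0, map_zero], (P.mem_Xsu_iff ψ).1 hψ u⟩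
  have hker : LinearMap.ker a = LinearMap.ker b := by
    ext u
    rw [LinearMap.mem_ker, LinearMap.mem_ker, hkera, hkerb, h]
  -- The map `a u ↦ b u`, well defined and injective because both kernels equal that of the common
  -- moment image.
  let g : LinearMap.range a ≃ₗ[ℂ] LinearMap.range b :=
    a.quotKerEquivRange.symm.trans ((Submodule.quotEquivOfEq _ _ hker).trans b.quotKerEquivRange)
  have hg : ∀ u (hu : a u ∈ LinearMap.range a), (g ⟨a u, hu⟩ : V) = b u := by
    intro u hu
    simp only [g, LinearEquiv.trans_apply]
    rw [LinearMap.quotKerEquivRange_symm_apply_image, Submodule.mkQ_apply,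
      Submodule.quotEquivOfEq_mk]
    rfl
  have hgL : ∀ u, P.left.L (g ⟨a u, a.mem_range_self u⟩) =
      g ⟨P.left.L (a u), P.L_mem_range_adjoint φ _ (a.mem_range_self u)⟩ := by
    intro u
    have e : (⟨P.left.L (a u), P.L_mem_range_adjoint φ _ (a.mem_range_self u)⟩ : LinearMap.range a) =
        ⟨a ((P.ι * s.star.epsDot) • P.right.L u), a.mem_range_self _⟩ := Subtype.ext (P.L_adjoint φ u)
    rw [e, hg, hg]
    exact P.L_adjoint ψ u
  have hgf : ∀ u v, P.left.form (g ⟨a u, a.mem_range_self u⟩) (g ⟨a v, a.mem_range_self v⟩) = P.left.form (a u) (a v) := by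
    intro u v
    rw [hg, hg, ha, hb, form_adjoint_adjoint, form_adjoint_adjoint, h]
  obtain ⟨k₀, hk₀⟩ := P.left.exists_isometry_extending (P.L_mem_range_adjoint φ)
    (P.L_mem_range_adjoint ψ) hφ hψ g (by rintro ⟨_, u, rfl⟩; exact hgL u)
    (by rintro ⟨_, u, rfl⟩ ⟨_, v, rfl⟩; exact hgf u v)
  obtain ⟨k, rfl⟩ := P.left.toIso_surjective k₀
  refine ⟨k, Subtype.ext (P.left.adjoint_injective P.right ?_)⟩
  rw [adjoint_smul, inv_one, P.right.act_one, LinearMap.comp_id]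
  ext u
  exact (hk₀ ⟨a u, u, rfl⟩).trans (hg u _)

/-- The image of `M'` is already attained on `𝒳^su`. -/
lemma exists_mem_Xsu_M'_eq (P : DualPair s s' V V') (φ : P.X) :
    ∃ ψ ∈ P.Xsu, P.M' ψ = P.M' φ := by
  set a := P.left.adjoint P.right φ with ha
  set W := LinearMap.range a with hW
  have hWL : ∀ v ∈ W, P.left.L v ∈ W := P.L_mem_range_adjoint φ
  -- `Q` complements the radical of `W` in all of `V`; since the radical lies in `W`, `Q ⊓ W`
  -- complements it inside `W`.
  obtain ⟨Q, hQL, hQ⟩ := exists_isCompl_of_sq_eq_smul s.star.epsDot_ne_zero P.left.L_sq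
    (p := W ⊓ P.left.form.orthogonal W) (by
      rintro v ⟨hv, hv'⟩
      refine ⟨hWL v hv, fun u hu => ?_⟩
      change P.left.form u (P.left.L v) = 0
      rw [P.left.form_L_right, show P.left.form (P.left.L u) v = 0 from hv' _ (hWL u hu), mul_zero])
  have hUL : ∀ v ∈ Q ⊓ W, P.left.L v ∈ Q ⊓ W := fun v hv => ⟨hQL v hv.1, hWL v hv.2⟩
  have hort : ∀ x ∈ W, (∀ u ∈ Q ⊓ W, P.left.form x u = 0) → ∀ w ∈ W, P.left.form x w = 0 := by
    intro x hx hxU w hw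
    obtain ⟨r, hr, q, hq, rfl⟩ := Submodule.mem_sup.1
      (hQ.sup_eq_top ▸ Submodule.mem_top : w ∈ (W ⊓ P.left.form.orthogonal W) ⊔ Q)
    rw [map_add, show P.left.form x r = 0 from hr.2 x hx,
      hxU q ⟨hq, (W.add_mem_iff_right hr.1).1 hw⟩, add_zero]
  have hU : (P.left.form.restrict (Q ⊓ W)).Nondegenerate := by
    refine LinearMap.BilinForm.nondegenerate_restrict_of_disjoint_orthogonal _
      P.left.form_isRefl (disjoint_iff.2 (eq_bot_iff.2 ?_))
    rintro x ⟨hx, hx'⟩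
    have h := hort x hx.2 fun u hu => P.left.form_isRefl _ _ (hx' u hu)
    rw [← hQ.inf_eq_bot]
    exact ⟨⟨hx.2, fun w hw => P.left.form_isRefl _ _ (h w hw)⟩, hx.1⟩
  obtain ⟨π, hπ, hid, hπort⟩ := P.left.exists_orthogonal_projection hU
  have hadj : P.left.adjoint P.right ((φ : V →ₗ[ℂ] V') ∘ₗ π) = π ∘ₗ a := by
    ext u
    refine P.left.eq_of_form_right fun v => ?_
    rw [P.left.form_adjoint, LinearMap.comp_apply, LinearMap.comp_apply,
      ← P.left.form_projection hπ hπort, ha, P.left.form_adjoint]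
  let ψ : P.X := ⟨(φ : V →ₗ[ℂ] V') ∘ₗ π, fun v' => by
    rw [hadj]
    simp only [LinearMap.comp_apply]
    rw [← P.left.projection_L hUL hπ hid hπort, ha, L_adjoint, map_smul, map_smul]⟩
  have hψ : P.left.adjoint P.right (ψ : V →ₗ[ℂ] V') = π ∘ₗ a := hadj
  refine ⟨ψ, ?_, ?_⟩
  · have hrange : LinearMap.range (P.left.adjoint P.right (ψ : V →ₗ[ℂ] V')) = Q ⊓ W := by
      rw [hψ]
      ext v
      constructor
      · rintro ⟨u, rfl⟩
        exact hπ _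
      · rintro hv
        obtain ⟨u, rfl⟩ := hv.2
        exact ⟨u, hid _ hv⟩
    change (P.left.form.restrict _).Nondegenerate
    rw [hrange]
    exact hU
  · refine Subtype.ext (LinearMap.ext fun u => P.right.eq_of_form_left fun v => ?_)
    -- It remains to see that `a u - π (a u)` pairs to zero with `W`: it lies in `W` and is
    -- orthogonal to `Q ⊓ W`, so `hort` applies.
    rw [← form_adjoint_adjoint, ← form_adjoint_adjoint, hψ, ← ha]
    simp only [LinearMap.comp_apply]
    rw [← P.left.form_projection hπ hπort, hid _ (hπ _), eq_comm, ← sub_eq_zero,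
      ← LinearMap.sub_apply, ← map_sub]
    refine hort _ (W.sub_mem ⟨u, rfl⟩ (hπ _).2) (fun w hw => hπort _ w hw) _ ⟨v, rfl⟩

end DualPair

/-! ### Polynomial maps and Zariski closed subsets -/

section PolynomialMaps

variable {E E₁ E₂ E₃ : Type*} [AddCommGroup E] [Module ℂ E] [AddCommGroup E₁] [Module ℂ E₁]
  [AddCommGroup E₂] [Module ℂ E₂] [AddCommGroup E₃] [Module ℂ E₃]

lemma dual_mem_polyFun (f : Dual ℂ E) : (fun x => f x) ∈ PolyFun E :=
  Algebra.subset_adjoin ⟨f, rfl⟩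

/-- A map between complex vector spaces is polynomial if its composite with every linear functional
is a polynomial function. -/
def IsPolyMap (F : E → E₁) : Prop := ∀ f : Dual ℂ E₁, (fun x => f (F x)) ∈ PolyFun E

lemma IsPolyMap.comp_mem {F : E → E₁} (hF : IsPolyMap F) {P : E₁ → ℂ} (hP : P ∈ PolyFun E₁) :
    (fun x => P (F x)) ∈ PolyFun E := by
  induction hP using Algebra.adjoin_induction with
  | mem P hP => obtain ⟨f, rfl⟩ := hP; exact hF f
  | algebraMap r => exact (PolyFun E).algebraMap_mem r
  | add P Q _ _ h₁ h₂ => exact (PolyFun E).add_mem h₁ h₂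
  | mul P Q _ _ h₁ h₂ => exact (PolyFun E).mul_mem h₁ h₂

lemma IsPolyMap.mem {F : E → ℂ} (hF : IsPolyMap F) : F ∈ PolyFun E := hF LinearMap.id

lemma isPolyMap_of_mem {F : E → ℂ} (hF : F ∈ PolyFun E) : IsPolyMap F := by
  intro f
  have h : (fun x => f (F x)) = f 1 • F := by
    funext x
    rw [Pi.smul_apply, smul_eq_mul, mul_comm, ← smul_eq_mul, ← map_smul, smul_eq_mul, mul_one]
  rw [h]
  exact (PolyFun E).smul_mem hF _

lemma isPolyMap_linear (F : E →ₗ[ℂ] E₁) : IsPolyMap F := fun f => dual_mem_polyFun (f ∘ₗ F)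

lemma isPolyMap_const (c : E₁) : IsPolyMap (fun _ : E => c) := fun f =>
  (PolyFun E).algebraMap_mem (f c)

lemma IsPolyMap.comp {G : E₁ → E₂} {F : E → E₁} (hG : IsPolyMap G) (hF : IsPolyMap F) :
    IsPolyMap (fun x => G (F x)) := fun f => hF.comp_mem (hG f)

lemma IsPolyMap.linear_comp {F : E → E₁} (hF : IsPolyMap F) (G : E₁ →ₗ[ℂ] E₂) :
    IsPolyMap (fun x => G (F x)) := (isPolyMap_linear G).comp hF

lemma IsPolyMap.fst {F : E → E₁ × E₂} (hF : IsPolyMap F) : IsPolyMap (fun x => (F x).1) :=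
  hF.linear_comp (LinearMap.fst ℂ E₁ E₂)

lemma IsPolyMap.snd {F : E → E₁ × E₂} (hF : IsPolyMap F) : IsPolyMap (fun x => (F x).2) :=
  hF.linear_comp (LinearMap.snd ℂ E₁ E₂)

lemma isPolyMap_id : IsPolyMap (fun x : E => x) := isPolyMap_linear LinearMap.id

lemma IsPolyMap.prodMk {F : E → E₁} {G : E → E₂} (hF : IsPolyMap F) (hG : IsPolyMap G) :
    IsPolyMap (fun x => (F x, G x)) := by
  intro f
  have h : (fun x => f (F x, G x)) =
      (fun x => (f ∘ₗ LinearMap.inl ℂ E₁ E₂) (F x)) +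
        fun x => (f ∘ₗ LinearMap.inr ℂ E₁ E₂) (G x) := by
    funext x
    simp [← map_add]
  rw [h]
  exact (PolyFun E).add_mem (hF _) (hG _)

/-- Expanding the first argument in a basis turns the expression into a finite sum of products of
polynomial functions. -/
lemma IsPolyMap.bilin [FiniteDimensional ℂ E₁] {F : E → E₁} {G : E → E₂} (hF : IsPolyMap F)
    (hG : IsPolyMap G) (β : E₁ →ₗ[ℂ] E₂ →ₗ[ℂ] E₃) : IsPolyMap (fun x => β (F x) (G x)) := by
  intro f
  let b := Module.finBasis ℂ E₁
  have h : (fun x => f (β (F x) (G x))) =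
      ∑ i, (fun x => b.coord i (F x)) * fun x => (f ∘ₗ β (b i)) (G x) := by
    funext x
    conv_lhs => rw [← b.sum_repr (F x)]
    simp only [map_sum, map_smul, LinearMap.sum_apply, LinearMap.smul_apply, smul_eq_mul,
      Finset.sum_apply, Pi.mul_apply, Basis.coord_apply, LinearMap.comp_apply]
  rw [h]
  exact (PolyFun E).sum_mem fun i _ => (PolyFun E).mul_mem (hF _) (hG _)

lemma IsPolyMap.linearMap_comp [FiniteDimensional ℂ E₁] [FiniteDimensional ℂ E₂]
    [FiniteDimensional ℂ E₃] {F : E → E₂ →ₗ[ℂ] E₃} {G : E → E₁ →ₗ[ℂ] E₂} (hF : IsPolyMap F)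
    (hG : IsPolyMap G) : IsPolyMap (fun x => F x ∘ₗ G x) :=
  hF.bilin hG (LinearMap.llcomp ℂ E₁ E₂ E₃)

lemma IsPolyMap.mul {F G : E → ℂ} (hF : IsPolyMap F) (hG : IsPolyMap G) :
    IsPolyMap (fun x => F x * G x) :=
  isPolyMap_of_mem ((PolyFun E).mul_mem hF.mem hG.mem)

lemma isPolyMap_det [FiniteDimensional ℂ E] :
    IsPolyMap (fun A : End ℂ E => LinearMap.det A) := by
  apply isPolyMap_of_mem
  let b := Module.finBasis ℂ E
  have h : (fun A : End ℂ E => LinearMap.det A) =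
      ∑ σ : Equiv.Perm (Fin (finrank ℂ E)), ((Equiv.Perm.sign σ : ℤ) : ℂ) •
        ∏ i, fun A : End ℂ E => (b.coord (σ i) ∘ₗ LinearMap.applyₗ (b i)) A := by
    funext A
    rw [← LinearMap.det_toMatrix b, Matrix.det_apply']
    simp [LinearMap.toMatrix_apply]
  rw [h]
  exact (PolyFun _).sum_mem fun σ _ => (PolyFun _).smul_mem
    ((PolyFun _).prod_mem fun i _ => dual_mem_polyFun _) _

lemma isZariskiClosed_iInter {ι : Sort*} {Z : ι → Set E} (h : ∀ i, IsZariskiClosed (Z i)) :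
    IsZariskiClosed {x | ∀ i, x ∈ Z i} := by
  choose S hS hZ using h
  refine ⟨⋃ i, S i, Set.iUnion_subset hS, ?_⟩
  ext x
  simp only [hZ, Set.mem_ofPred_eq, Set.mem_iUnion]
  exact ⟨fun h f ⟨i, hi⟩ => h i f hi, fun h i f hi => h f ⟨i, hi⟩⟩

lemma IsZariskiClosed.and {p q : E → Prop} (hp : IsZariskiClosed {x | p x})
    (hq : IsZariskiClosed {x | q x}) : IsZariskiClosed {x | p x ∧ q x} := by
  obtain ⟨S, hS, hpS⟩ := hp
  obtain ⟨T, hT, hqT⟩ := hq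
  refine ⟨S ∪ T, Set.union_subset hS hT, ?_⟩
  ext x
  have h₁ : p x ↔ _ := Set.ext_iff.1 hpS x
  have h₂ : q x ↔ _ := Set.ext_iff.1 hqT x
  simp only [Set.mem_ofPred_eq] at h₁ h₂ ⊢
  rw [h₁, h₂]
  simp only [Set.mem_union, or_imp, forall_and]

lemma isZariskiClosed_eq {F G : E → E₁} (hF : IsPolyMap F) (hG : IsPolyMap G) :
    IsZariskiClosed {x | F x = G x} := by
  refine ⟨Set.range fun f : Dual ℂ E₁ => fun x => f (F x) - f (G x), ?_, ?_⟩
  · rintro _ ⟨f, rfl⟩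
    exact (PolyFun E).sub_mem (hF f) (hG f)
  · ext x
    simp only [Set.mem_ofPred_eq, Set.forall_mem_range, sub_eq_zero]
    exact ⟨fun h f => by rw [h], fun h => sub_eq_zero.1
      ((Module.forall_dual_apply_eq_zero_iff ℂ _).1 fun f => by rw [map_sub, h, sub_self])⟩

lemma IsZariskiClosed.preimage {Z : Set E₁} (hZ : IsZariskiClosed Z) {F : E → E₁}
    (hF : IsPolyMap F) : IsZariskiClosed {x | F x ∈ Z} := by
  obtain ⟨S, hS, rfl⟩ := hZ
  refine ⟨(fun P x => P (F x)) '' S, ?_, ?_⟩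
  · rintro _ ⟨P, hP, rfl⟩
    exact hF.comp_mem (hS hP)
  · ext x
    simp

/-- A subgroup cut out by an algebraic condition, in a group with injective coordinates with closed
range in which multiplication and inversion are given by polynomial maps. -/
lemma isAffineAlgebraicGroup_subgroup {H : Type*} [Group H] {c : H → E}
    (hinj : Function.Injective c) (hcl : IsZariskiClosed (Set.range c)) {m : E × E → E} {i : E → E}
    (hm : IsPolyMap m) (hi : IsPolyMap i) (hcm : ∀ g h, c (g * h) = m (c g, c h))
    (hci : ∀ g, c g⁻¹ = i (c g)) (H' : Subgroup H) {F G : E → E₁} (hF : IsPolyMap F)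
    (hG : IsPolyMap G) (hH' : ∀ g, g ∈ H' ↔ F (c g) = G (c g)) :
    IsAffineAlgebraicGroup (fun g : H' => c g) where
  injective := hinj.comp Subtype.val_injective
  closed := by
    have : Set.range (fun g : H' => c g) = {x | x ∈ Set.range c ∧ F x = G x} := by
      ext x
      constructor
      · rintro ⟨g, rfl⟩
        exact ⟨⟨g, rfl⟩, (hH' g).1 g.2⟩
      · rintro ⟨⟨g, rfl⟩, h⟩
        exact ⟨⟨g, (hH' g).2 h⟩, rfl⟩
    rw [this]
    exact hcl.and (isZariskiClosed_eq hF hG)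
  regular_mul P hP := ⟨_, hm.comp_mem hP, fun g h => by rw [Subgroup.coe_mul, hcm]⟩
  regular_inv P hP := ⟨_, hi.comp_mem hP, fun g => by rw [Subgroup.coe_inv, hci]⟩

lemma isRegularMap_of_isPolyMap {H₁ H₂ : Type*} {c₁ : H₁ → E₁} {c₂ : H₂ → E₂} {f : H₁ → H₂}
    {F : E₁ → E₂} (hF : IsPolyMap F) (h : ∀ x, c₂ (f x) = F (c₁ x)) : IsRegularMap c₁ c₂ f :=
  fun _ hP => ⟨_, hF.comp_mem hP, fun x => by rw [h]⟩

end PolynomialMaps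

/-! ### The algebraic group structure of `𝐊` -/

namespace ClassicalSpace

section OneSpace

variable {s : ClassicalSignature} {V : Type*} [AddCommGroup V] [Module ℂ V]

lemma coord_injective (S : ClassicalSpace s V) : Function.Injective S.coord := by
  intro k l h
  have h₁ : S.act k = S.act l := congrArg (fun x => x.1.1) h
  have h₂ : ((k.1.2 : ℂˣ) : ℂ) = l.1.2 := congrArg (fun x => x.2.1) h
  apply Subtype.ext
  refine Prod.ext (Subtype.ext (LinearEquiv.ext fun v => ?_)) (Units.ext h₂)
  exact LinearMap.congr_fun h₁ v

/-- Multiplication of `𝐊` in coordinates. -/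
def coordMul (x : ((End ℂ V × End ℂ V) × (ℂ × ℂ)) × ((End ℂ V × End ℂ V) × (ℂ × ℂ))) :
    (End ℂ V × End ℂ V) × (ℂ × ℂ) :=
  ((x.1.1.1 ∘ₗ x.2.1.1, x.2.1.2 ∘ₗ x.1.1.2), (x.1.2.1 * x.2.2.1, x.2.2.2 * x.1.2.2))

/-- Inversion of `𝐊` in coordinates. -/
def coordInv (x : (End ℂ V × End ℂ V) × (ℂ × ℂ)) : (End ℂ V × End ℂ V) × (ℂ × ℂ) :=
  ((x.1.2, x.1.1), (x.2.2, x.2.1))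

lemma coord_mul (S : ClassicalSpace s V) (k l : S.complexK) :
    S.coord (k * l) = coordMul (S.coord k, S.coord l) := by
  simp [coord, coordMul, mul_inv_rev, act_mul]

/-- Recording `k` and `k⁻¹` together makes inversion a swap of entries. -/
lemma coord_inv (S : ClassicalSpace s V) (k : S.complexK) :
    S.coord k⁻¹ = coordInv (S.coord k) := by
  simp [coord, coordInv]

lemma isPolyMap_coordInv : IsPolyMap (coordInv (V := V)) :=
  (isPolyMap_id.fst.snd.prodMk isPolyMap_id.fst.fst).prodMk
    (isPolyMap_id.snd.snd.prodMk isPolyMap_id.snd.fst)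

variable [FiniteDimensional ℂ V]

lemma isPolyMap_coordMul : IsPolyMap (coordMul (V := V)) :=
  ((isPolyMap_id.fst.fst.fst.linearMap_comp isPolyMap_id.snd.fst.fst).prodMk
    (isPolyMap_id.snd.fst.snd.linearMap_comp isPolyMap_id.fst.fst.snd)).prodMk
    ((isPolyMap_id.fst.snd.fst.mul isPolyMap_id.snd.snd.fst).prodMk
    (isPolyMap_id.snd.snd.snd.mul isPolyMap_id.fst.snd.snd))

lemma isZariskiClosed_range_coord (S : ClassicalSpace s V) :
    IsZariskiClosed (Set.range S.coord) := by
  -- A linear retraction `r` onto the `i`-eigenspace makes the determinant condition a polynomial in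
  -- every endomorphism, including those that do not preserve the eigenspace.
  obtain ⟨r, hr⟩ := (End.eigenspace S.L Complex.I).subtype.exists_leftInverse_of_injective
    (Submodule.ker_subtype _)
  have hres : ∀ g : S.isometryGroupL, r ∘ₗ ((g : V ≃ₗ[ℂ] V) : V →ₗ[ℂ] V) ∘ₗ
      (End.eigenspace S.L Complex.I).subtype = S.resI g := by
    intro g
    ext v
    exact congrArg Subtype.val (LinearMap.congr_fun hr (S.resI g v))
  have : Set.range S.coord = {x | ((x.1.1 ∘ₗ x.1.2 = LinearMap.id ∧ x.1.2 ∘ₗ x.1.1 = LinearMap.id) ∧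
      (x.2.1 * x.2.2 = 1 ∧ x.1.1 ∘ₗ S.L = S.L ∘ₗ x.1.1)) ∧
      ((∀ u v, S.form (x.1.1 u) (x.1.1 v) = S.form u v) ∧
      ((∀ _ : s.star = .Ctilde, x.2.1 * x.2.1 = LinearMap.det
        (r ∘ₗ x.1.1 ∘ₗ (End.eigenspace S.L Complex.I).subtype)) ∧
      ∀ _ : s.star ≠ .Ctilde, x.2.1 = 1))} := by
    ext x
    constructor
    · rintro ⟨k, rfl⟩
      refine ⟨⟨⟨?_, ?_⟩, ?_, ?_⟩, S.form_act k, fun h => ?_, fun h => ?_⟩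
      · exact LinearMap.ext (S.act_act_inv k)
      · exact LinearMap.ext (S.act_inv_act k)
      · simp [coord]
      · exact LinearMap.ext (S.act_L k)
      · have h' := k.2.1 h
        rw [sq] at h'
        exact h'.trans (by rw [← hres]; rfl)
      · exact congrArg Units.val (k.2.2 h)
    · rcases x with ⟨⟨A, B⟩, t, u⟩
      rintro ⟨⟨⟨hAB, hBA⟩, htu, hL⟩, hf, ht, ht'⟩
      let g : S.isometryGroupL := ⟨LinearEquiv.ofLinearMap A B hAB hBA, hf, LinearMap.congr_fun hL⟩
      let k : S.complexK := ⟨(g, ⟨t, u, htu, by rw [mul_comm]; exact htu⟩),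
        fun h => by rw [sq]; exact (ht h).trans (by rw [← hres]; rfl), fun h => Units.ext (ht' h)⟩
      exact ⟨k, rfl⟩
  rw [this]
  have hA : IsPolyMap fun x : (End ℂ V × End ℂ V) × (ℂ × ℂ) => x.1.1 := isPolyMap_id.fst.fst
  have hB : IsPolyMap fun x : (End ℂ V × End ℂ V) × (ℂ × ℂ) => x.1.2 := isPolyMap_id.fst.snd
  have ht : IsPolyMap fun x : (End ℂ V × End ℂ V) × (ℂ × ℂ) => x.2.1 := isPolyMap_id.snd.fst
  have hu : IsPolyMap fun x : (End ℂ V × End ℂ V) × (ℂ × ℂ) => x.2.2 := isPolyMap_id.snd.snd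
  refine (((isZariskiClosed_eq (hA.linearMap_comp hB) (isPolyMap_const _)).and
    (isZariskiClosed_eq (hB.linearMap_comp hA) (isPolyMap_const _))).and
    ((isZariskiClosed_eq (ht.mul hu) (isPolyMap_const _)).and
    (isZariskiClosed_eq (hA.linearMap_comp (isPolyMap_const _))
      ((isPolyMap_const _).linearMap_comp hA)))).and (IsZariskiClosed.and ?_
    (IsZariskiClosed.and ?_ ?_))
  · refine isZariskiClosed_iInter fun u => isZariskiClosed_iInter fun v => ?_
    exact isZariskiClosed_eq ((hA.linear_comp (LinearMap.applyₗ u)).bilin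
      (hA.linear_comp (LinearMap.applyₗ v)) S.form) (isPolyMap_const _)
  -- A condition imposed only for some labels is an intersection indexed by a proposition.
  · refine isZariskiClosed_iInter fun _ => isZariskiClosed_eq (ht.mul ht) ?_
    exact isPolyMap_det.comp ((isPolyMap_const r).linearMap_comp
      (hA.linearMap_comp (isPolyMap_const _)))
  · exact isZariskiClosed_iInter fun _ => isZariskiClosed_eq ht (isPolyMap_const _)

lemma isAffineAlgebraicGroup_stabilizer_pSpace (S : ClassicalSpace s V) (e : S.pSpace) :
    IsAffineAlgebraicGroup fun k : MulAction.stabilizer S.complexK e => S.coord k :=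
  isAffineAlgebraicGroup_subgroup S.coord_injective S.isZariskiClosed_range_coord
    isPolyMap_coordMul isPolyMap_coordInv S.coord_mul S.coord_inv _
    (F := fun x => x.1.1 ∘ₗ (e : End ℂ V) ∘ₗ x.1.2) (G := fun _ => (e : End ℂ V))
    (isPolyMap_id.fst.fst.linearMap_comp ((isPolyMap_const _).linearMap_comp isPolyMap_id.fst.snd))
    (isPolyMap_const _) fun _ => Subtype.ext_iff

end OneSpace

end ClassicalSpace

/-! ### Algebraicity of the stabilizers in `𝒳` -/

namespace DualPair

open ClassicalSpace

variable {s s' : ClassicalSignature} {V V' : Type*} [AddCommGroup V] [Module ℂ V]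
  [FiniteDimensional ℂ V] [AddCommGroup V'] [Module ℂ V'] [FiniteDimensional ℂ V']

lemma isAffineAlgebraicGroup_stabilizer_left (P : DualPair s s' V V') (φ : P.X) :
    IsAffineAlgebraicGroup fun k : MulAction.stabilizer P.K φ => P.left.coord k :=
  isAffineAlgebraicGroup_subgroup P.left.coord_injective P.left.isZariskiClosed_range_coord
    isPolyMap_coordMul isPolyMap_coordInv P.left.coord_mul P.left.coord_inv _
    (F := fun x => (φ : V →ₗ[ℂ] V') ∘ₗ x.1.2) (G := fun _ => (φ : V →ₗ[ℂ] V'))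
    ((isPolyMap_const _).linearMap_comp isPolyMap_id.fst.snd)
    (isPolyMap_const _) fun _ => Subtype.ext_iff

lemma isZariskiClosed_range_coordProd (P : DualPair s s' V V') :
    IsZariskiClosed (Set.range P.coordProd) := by
  have : Set.range P.coordProd =
      {x | x.1 ∈ Set.range P.left.coord ∧ x.2 ∈ Set.range P.right.coord} :=
    Set.range_prodMap
  rw [this]
  exact (P.left.isZariskiClosed_range_coord.preimage isPolyMap_id.fst).and
    (P.right.isZariskiClosed_range_coord.preimage isPolyMap_id.snd)

lemma isAffineAlgebraicGroup_stabilizer_prod (P : DualPair s s' V V') (φ : P.X) :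
    IsAffineAlgebraicGroup
      fun x : MulAction.stabilizer (P.K × P.K') φ => P.coordProd x :=
  isAffineAlgebraicGroup_subgroup (P.left.coord_injective.prodMap P.right.coord_injective)
    P.isZariskiClosed_range_coordProd
    (m := fun x => (coordMul (x.1.1, x.2.1), coordMul (x.1.2, x.2.2)))
    (i := fun x => (coordInv x.1, coordInv x.2))
    ((isPolyMap_coordMul.comp (isPolyMap_id.fst.fst.prodMk isPolyMap_id.snd.fst)).prodMk
      (isPolyMap_coordMul.comp (isPolyMap_id.fst.snd.prodMk isPolyMap_id.snd.snd)))
    ((isPolyMap_coordInv.comp isPolyMap_id.fst).prodMk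
      (isPolyMap_coordInv.comp isPolyMap_id.snd))
    (fun g h => Prod.ext (P.left.coord_mul g.1 h.1) (P.right.coord_mul g.2 h.2))
    (fun g => Prod.ext (P.left.coord_inv g.1) (P.right.coord_inv g.2)) _
    (F := fun x => x.2.1.1 ∘ₗ (φ : V →ₗ[ℂ] V') ∘ₗ x.1.1.2) (G := fun _ => (φ : V →ₗ[ℂ] V'))
    (isPolyMap_id.snd.fst.fst.linearMap_comp
      ((isPolyMap_const _).linearMap_comp isPolyMap_id.fst.fst.snd))
    (isPolyMap_const _) fun _ => Subtype.ext_iff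

end DualPair

/-! ### Descent of orbits -/

theorem mainTheorem7 {s s' : ClassicalSignature} {V V' : Type*}
    [AddCommGroup V] [Module ℂ V] [FiniteDimensional ℂ V]
    [AddCommGroup V'] [Module ℂ V'] [FiniteDimensional ℂ V']
    (P : DualPair s s' V V') (O' : Set P.p')
    (hO' : ∃ X' : P.p', O' = MulAction.orbit P.K' X')
    (him : O' ⊆ Set.range P.M') :
    (∃ φ₀ : P.X, P.M' ⁻¹' O' ∩ P.Xsu = MulAction.orbit (P.K × P.K') φ₀) ∧
      ∀ φ ∈ P.M' ⁻¹' O' ∩ P.Xsu,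
        IsExactSeqOfAlgebraicGroups
          (fun k : MulAction.stabilizer P.K φ => P.left.coord k)
          (fun x : MulAction.stabilizer (P.K × P.K') φ => P.coordProd x)
          (fun k' : MulAction.stabilizer P.K' (P.M' φ) => P.right.coord k')
          (P.stabIncl φ) (P.stabProj φ) := by
  obtain ⟨X', rfl⟩ := hO'
  constructor
  · obtain ⟨φ₁, rfl⟩ := him (MulAction.mem_orbit_self X')
    obtain ⟨φ₀, hφ₀, h₀⟩ := P.exists_mem_Xsu_M'_eq φ₁
    refine ⟨φ₀, Set.Subset.antisymm ?_ ?_⟩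
    · rintro φ ⟨⟨k', hk'⟩, hφ⟩
      have hk'' : k' • P.M' φ₁ = P.M' φ := hk'
      -- Moving `φ₀` by `k'` first puts it in the fibre of `φ`, where `𝐊` acts transitively on
      -- `𝒳^su`.
      obtain ⟨k, hk⟩ := P.exists_smul_eq_of_M'_eq (P.smul_mem_Xsu (1, k') hφ₀) hφ
        (by rw [P.M'_smul, h₀, hk''])
      rw [← mul_smul] at hk
      exact ⟨_, hk⟩
    · rintro _ ⟨x, rfl⟩
      refine ⟨⟨x.2, ?_⟩, P.smul_mem_Xsu x hφ₀⟩
      change x.2 • P.M' φ₁ = P.M' (x • φ₀)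
      rw [P.M'_smul, h₀]
  · rintro φ ⟨-, hφ⟩
    refine ⟨P.isAffineAlgebraicGroup_stabilizer_left φ, P.isAffineAlgebraicGroup_stabilizer_prod φ,
      P.right.isAffineAlgebraicGroup_stabilizer_pSpace _,
      isRegularMap_of_isPolyMap (isPolyMap_id.prodMk (isPolyMap_const (P.right.coord 1)))
        fun _ => rfl,
      isRegularMap_of_isPolyMap isPolyMap_id.snd fun _ => rfl, ?_, ?_, ?_⟩
    · intro k l h
      exact Subtype.ext (congrArg (fun x => x.1.1) h)
    · ext x
      constructor
      · rintro ⟨k, rfl⟩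
        rfl
      · intro h
        have h2 : (x : P.K × P.K').2 = 1 := congrArg Subtype.val h
        have hx : ((x : P.K × P.K').1, (1 : P.K')) = (x : P.K × P.K') := Prod.ext rfl h2.symm
        refine ⟨⟨(x : P.K × P.K').1, ?_⟩, Subtype.ext hx⟩
        change (((x : P.K × P.K').1, (1 : P.K')) : P.K × P.K') • φ = φ
        rw [hx]
        exact x.2
    · intro k'
      -- Since `k'` fixes `M'(φ)`, the point `(1, k') • φ` stays in the fibre of `φ`, and some `k`
      -- brings it back to `φ`.
      obtain ⟨k, hk⟩ := P.exists_smul_eq_of_M'_eq (P.smul_mem_Xsu (1, (k' : P.K')) hφ) hφ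
        (by rw [P.M'_smul]; exact k'.2)
      rw [← mul_smul] at hk
      exact ⟨⟨_, hk⟩, Subtype.ext (one_mul _)⟩
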